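/- **Setting.** For $d,t,n\in\mathbb N$, $L>0$ and $\sigma:\mathbb R\to\mathbb R$, let $\mathcal N_{t,n,\sigma,L}$ be the class of functions $f:\mathbb R^d\to\mathbb R$ computed by a layered feed-forward neural network with $t$ layers and $n$ neurons (input neurons not counted), one output neuron, activation $\sigma$ on all neurons except the output neuron (which outputs its weighted sum plus bias), in which the input weights $\mathbf w$ and the bias $b$ of every neuron satisfy $\|\mathbf w\|_1+|b|\le L$. Let $\sigma_{\mathrm{sig}}(z)=1/(1+e^{-z})$. *Learning.* Instances are points of $\{0,1\}^d$. A learning algorithm receives $d$ and $\lceil 1/\epsilon\rceil$ and has access to an oracle that returns independent examples $(\mathbf x,\mathrm{sign}(f^*(\mathbf x)))$, where $\mathbf x$ is drawn from an unknown distribution $D$ on $\{0,1\}^d$ and $f^*$ is an unknown function of the class that satisfies the margin assumption $|f^*(\mathbf x)|\ge 1$ for $D$-almost every $\mathbf x$. It learns to accuracy $\epsilon$ with confidence $1-\delta$ in time $t$ if it always halts within $t$ steps and returns a classifier $h:\{0,1\}^d\to\{\pm1\}$ that can be evaluated on any new instance in at most $t$ steps and for which, with probability at least $1-\delta$, $\mathbb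 P_{\mathbf x\sim D}[h(\mathbf x)\ne \mathrm{sign}(f^*(\mathbf x))]\le\epsilon$. Steps are those of a random access machine over the integers with unit-cost addition, subtraction, comparison with zero, indirect memory access, and access to the examples. **Theorem.** There is an absolute constant $c\in\mathbb N$ such that for every $\delta\in(0,1)$ there is a constant $K>0$ with the following property. For every $L>0$ there is an algorithm that, for all $d\ge1$, all $\epsilon\in(0,1)$, all $n$, every distribution $D$ on $\{0,1\}^d$ and every target $f^*\in\mathcal N_{2,n,\sigma_{\mathrm{sig}},L}$ satisfying the margin assumption, learns $f^*$ to accuracy $\epsilon$ with confidence $1-\delta$ in time $T^c$, where $$T=\frac1\epsilon\cdot K\,d^{\,4L\ln(11L^2+1)} .$$ -/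

import Mathlib

open MeasureTheory

/-! ### Layered neural networks -/

/-- Every neuron of a layer with weights `W` and biases `b` has input weights of `ℓ₁`-norm
at most `L`, the bias included. -/
def LayerBounded {k m : ℕ} (L : ℝ) (W : Matrix (Fin k) (Fin m) ℝ) (b : Fin k → ℝ) : Prop :=
  ∀ i, ∑ j, |W i j| + |b i| ≤ L

/-- `NetMaps σ L d t n k` is the set of maps `ℝᵈ → ℝᵏ` computed by a feed-forward network with
`t` layers, `n` neurons in total (input neurons are not counted), `k` of them in the last layer,
such that every neuron obeys the weight bound `L`. The neurons of the last layer output their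
weighted sums, all others pass them through the activation `σ`. -/
def NetMaps (σ : ℝ → ℝ) (L : ℝ) (d : ℕ) :
    ℕ → ℕ → (k : ℕ) → Set ((Fin d → ℝ) → (Fin k → ℝ))
  | 0, _, _ => ∅
  | 1, n, k =>
      {F | n = k ∧ ∃ (W : Matrix (Fin k) (Fin d) ℝ) (b : Fin k → ℝ),
        LayerBounded L W b ∧ ∀ x i, F x i = ∑ j, W i j * x j + b i}
  | t + 2, n, k =>
      {F | ∃ n₀ m : ℕ, n = n₀ + k ∧ ∃ G ∈ NetMaps σ L d (t + 1) n₀ m,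
        ∃ (W : Matrix (Fin k) (Fin m) ℝ) (b : Fin k → ℝ),
          LayerBounded L W b ∧ ∀ x i, F x i = ∑ j, W i j * σ (G x j) + b i}

/-- The class `𝒩_{t,n,σ,L}` of real-valued target functions on `ℝᵈ`: depth `t`, size `n`,
activation `σ`, weight bound `L`, one output neuron. -/
def NetClass (d t n : ℕ) (σ : ℝ → ℝ) (L : ℝ) : Set ((Fin d → ℝ) → ℝ) :=
  {f | ∃ F ∈ NetMaps σ L d t n 1, ∀ x, f x = F x 0}

/-- The instance space `{0,1}ᵈ`. -/
abbrev Cube (d : ℕ) : Type := Fin d → Bool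

/-- A point of `{0,1}ᵈ` as a real vector. -/
def Cube.toReal {d : ℕ} (x : Cube d) : Fin d → ℝ := fun i => if x i then 1 else 0

/-! ### Random access machines with an example oracle -/

/-- Programs of a random access machine with integer registers and an integer-addressed memory of
integers. The only arithmetic is addition and subtraction, so that the bit length of the numbers
grows by at most one per step and the unit-cost step count is polynomially related to the running
time of a Turing machine. The machine has random access to the current example and may ask for the
next one. -/
inductive Cmd : Type
  /-- do nothing -/
  | skip : Cmd
  /-- register `r` gets the constant `z` -/
  | const (r : ℕ) (z : ℤ) : Cmd
  /-- register `r` gets the sum of the registers `p` and `q` -/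
  | add (r p q : ℕ) : Cmd
  /-- register `r` gets the difference of the registers `p` and `q` -/
  | sub (r p q : ℕ) : Cmd
  /-- register `r` gets the memory cell whose address is in register `p` -/
  | load (r p : ℕ) : Cmd
  /-- the memory cell whose address is in register `p` gets the content of register `q` -/
  | store (p q : ℕ) : Cmd
  /-- register `r` gets the coordinate of the current instance whose index is in register `p` -/
  | coord (r p : ℕ) : Cmd
  /-- register `r` gets the label of the current example -/
  | label (r : ℕ) : Cmd
  /-- move on to the next example -/
  | advance : Cmd
  /-- sequential composition -/
  | seq (A B : Cmd) : Cmd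
  /-- run `A` if register `r` is positive, and `B` otherwise -/
  | cond (r : ℕ) (A B : Cmd) : Cmd
  /-- run `A` as long as register `r` is positive -/
  | loop (r : ℕ) (A : Cmd) : Cmd

/-- The state of the machine: registers, memory, and the index of the current example. -/
structure MState : Type where
  reg : ℕ → ℤ
  mem : ℤ → ℤ
  pos : ℕ

/-- The state `s` with register `r` set to `z`. -/
def MState.setReg (s : MState) (r : ℕ) (z : ℤ) : MState :=
  { s with reg := Function.update s.reg r z }

/-- The state `s` with memory cell `a` set to `z`. -/
def MState.setMem (s : MState) (a z : ℤ) : MState :=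
  { s with mem := Function.update s.mem a z }

/-- The state `s` with the next example being the current one. -/
def MState.nextExample (s : MState) : MState :=
  { s with pos := s.pos + 1 }

/-- The coordinate of `x` with index `a` (counted from `0`), as the integer `0` or `1`;
`0` if there is no such coordinate. -/
def Cube.get {d : ℕ} (x : Cube d) (a : ℤ) : ℤ :=
  if h : 0 ≤ a ∧ a.toNat < d then (if x ⟨a.toNat, h.2⟩ then 1 else 0) else 0

/-- `Exec S A s τ s'`: on the sequence `S` of examples, the program `A` started in state `s`
halts in state `s'` after exactly `τ` steps. Each elementary instruction and each test of a
conditional or of a loop is one step. -/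
inductive Exec {d : ℕ} (S : ℕ → Cube d × SignType) : Cmd → MState → ℕ → MState → Prop
  | skip (s) : Exec S .skip s 1 s
  | const (r z s) : Exec S (.const r z) s 1 (s.setReg r z)
  | add (r p q s) : Exec S (.add r p q) s 1 (s.setReg r (s.reg p + s.reg q))
  | sub (r p q s) : Exec S (.sub r p q) s 1 (s.setReg r (s.reg p - s.reg q))
  | load (r p s) : Exec S (.load r p) s 1 (s.setReg r (s.mem (s.reg p)))
  | store (p q s) : Exec S (.store p q) s 1 (s.setMem (s.reg p) (s.reg q))
  | coord (r p s) : Exec S (.coord r p) s 1 (s.setReg r ((S s.pos).1.get (s.reg p)))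
  | label (r s) : Exec S (.label r) s 1 (s.setReg r ((S s.pos).2 : ℤ))
  | advance (s) : Exec S .advance s 1 s.nextExample
  | seq {A B s₀ s₁ s₂ τ₁ τ₂} : Exec S A s₀ τ₁ s₁ → Exec S B s₁ τ₂ s₂ →
      Exec S (.seq A B) s₀ (τ₁ + τ₂) s₂
  | cond_pos {r A B s s' τ} : 0 < s.reg r → Exec S A s τ s' →
      Exec S (.cond r A B) s (τ + 1) s'
  | cond_neg {r A B s s' τ} : ¬ 0 < s.reg r → Exec S B s τ s' →
      Exec S (.cond r A B) s (τ + 1) s'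
  | loop_pos {r A s₀ s₁ s₂ τ₁ τ₂} : 0 < s₀.reg r → Exec S A s₀ τ₁ s₁ →
      Exec S (.loop r A) s₁ τ₂ s₂ → Exec S (.loop r A) s₀ (τ₁ + τ₂ + 1) s₂
  | loop_neg {r A s} : ¬ 0 < s.reg r → Exec S (.loop r A) s 1 s

/-- The machine is deterministic: final state and number of steps are determined by the program,
the examples and the initial state. -/
theorem Exec.deterministic {d : ℕ} {S : ℕ → Cube d × SignType} {A : Cmd} {s s₁ s₂ : MState}
    {τ₁ τ₂ : ℕ} (h₁ : Exec S A s τ₁ s₁) (h₂ : Exec S A s τ₂ s₂) : τ₁ = τ₂ ∧ s₁ = s₂ := by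
  induction h₁ generalizing τ₂ s₂ with
  | seq _ _ ihA ihB =>
    cases h₂ with
    | seq hA hB =>
      obtain ⟨rfl, rfl⟩ := ihA hA
      obtain ⟨rfl, rfl⟩ := ihB hB
      exact ⟨rfl, rfl⟩
  | cond_pos hr _ ih =>
    cases h₂ with
    | cond_pos _ h =>
      obtain ⟨rfl, rfl⟩ := ih h
      exact ⟨rfl, rfl⟩
    | cond_neg hn _ => exact absurd hr hn
  | cond_neg hr _ ih =>
    cases h₂ with
    | cond_pos hp _ => exact absurd hp hr
    | cond_neg _ h =>
      obtain ⟨rfl, rfl⟩ := ih h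
      exact ⟨rfl, rfl⟩
  | loop_pos hr _ _ ihA ihB =>
    cases h₂ with
    | loop_pos _ hA hB =>
      obtain ⟨rfl, rfl⟩ := ihA hA
      obtain ⟨rfl, rfl⟩ := ihB hB
      exact ⟨rfl, rfl⟩
    | loop_neg hn => exact absurd hr hn
  | loop_neg hr =>
    cases h₂ with
    | loop_pos hp _ _ => exact absurd hp hr
    | loop_neg _ => exact ⟨rfl, rfl⟩
  | _ => cases h₂; exact ⟨rfl, rfl⟩

/-! ### Learning -/

/-- The initial state of a learner: register `0` holds the dimension `d`, register `1` holds
`⌈1/ε⌉`, everything else is zero. -/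
noncomputable def learnerStart (d : ℕ) (ε : ℝ) : MState where
  reg := fun r => if r = 0 then (d : ℤ) else if r = 1 then ⌈1 / ε⌉ else 0
  mem := fun _ => 0
  pos := 0

/-- The label in `{-1, 1}` that a halted machine announces through register `0`. -/
def MState.output (s : MState) : SignType := if 0 < s.reg 0 then 1 else -1

/-- The examples `(x, sign (f x))` for the instances `x = ω 0, ω 1, …`. -/
noncomputable def labelled {d : ℕ} (f : (Fin d → ℝ) → ℝ) (ω : ℕ → Cube d) :
    ℕ → Cube d × SignType :=
  fun i => (ω i, SignType.sign (f (ω i).toReal))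

/-- The learning program `A`, with `Q` as the program that evaluates the returned classifier,
learns the target `f` under the distribution `D` to accuracy `ε` with confidence `1 - δ` within
time `t`: for every sequence of instances `ω`, the learner `A` halts within `t` steps; from the
state it leaves behind, `Q` computes within `t` steps the label `h ω x` of any new (unlabelled)
instance `x`; and for instances drawn independently from `D`, the classifier `h ω` has error at
most `ε` with probability at least `1 - δ`. -/
def LearnsWithin (A Q : Cmd) {d : ℕ} (ε δ t : ℝ) (f : (Fin d → ℝ) → ℝ)
    (D : Measure (Cube d)) [IsProbabilityMeasure D] : Prop :=
  ∃ h : (ℕ → Cube d) → Cube d → SignType,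
    (∀ ω : ℕ → Cube d, ∃ (τ : ℕ) (s : MState),
      Exec (labelled f ω) A (learnerStart d ε) τ s ∧ (τ : ℝ) ≤ t ∧
      ∀ x : Cube d, ∃ (τ' : ℕ) (s' : MState),
        Exec (fun _ => (x, 0)) Q s τ' s' ∧ (τ' : ℝ) ≤ t ∧ h ω x = s'.output) ∧
    1 - δ ≤ (Measure.infinitePi (fun _ : ℕ => D)).real
      {ω | D.real {x | h ω x ≠ SignType.sign (f x.toReal)} ≤ ε}

/-!
The learner is a perceptron with the polynomial kernel `(z, x) ↦ (1 + ⟨z, x⟩) ^ r`, and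
`r ≈ L ln (11 L² + 1)`.

*Approximation.* The complex sigmoid function is bounded by `1` on the strip `|Im w| ≤ π / 2`.
Shifting the contour in the Fourier coefficients of `θ ↦ σ (L cos θ)` by `± 1 / L` therefore shows
that the Chebyshev coefficients of `σ` on `[-L, L]` decay like `exp (-n / L)`
(`norm_fourierCoeff_sigmoidCos_le`), so that the truncated series approximates `σ` to within
`1 / (2 L)` as soon as `exp (r / L) ≥ 8 L²` (`exists_chebyshev_sigmoid_approx`). The recursion of the
Chebyshev polynomials bounds the coefficients of the resulting polynomial on the cube by
`2 L 3 ^ r` in `ℓ₁`-norm (`exists_polyRep_of_mem_netClass`). Under the margin assumption this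
polynomial has the sign of the target and absolute value at least `1 / 2`.

*Mistake bound.* The kernel is the inner product of the vectors of all monomials `x_{α 1} ⋯ x_{α r}`,
whose squared norm is at most `(d + 1) ^ r`, so the perceptron makes at most
`4 (2 L 3 ^ r)² (d + 1) ^ r` mistakes (`PerceptronInv.length_le`). For `d ≥ 2` this is less than
`Y = (d + 1) ^ q` with `q = O(L ln (11 L² + 1))`, hence polynomial in `d ^ (4 L ln (11 L² + 1))` with
an absolute exponent. In dimension one that power is `1` for every `L`; there the learner uses `r = 1`
instead, since every labelling of `{0, 1}` is linear. For `L < 1` no target satisfies the margin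
assumption.

*Generalization.* The learner stops changing its classifier once this has been correct on
`k = 2 ⌈1/δ⌉ ⌈1/ε⌉² Y` consecutive examples, which happens among the first `k Y` examples
(`exists_perceptronRun_survivor`). The classifier at time `t` depends on the examples before `t` only,
so the probability that it is bad and survives the next `k` examples is at most `(1 - ε) ^ k`
(`measureReal_large_and_avoids_le`), and a union bound over `t` finishes the argument.

*Machine.* The programs are verified with weakest preconditions (`WP`). The running time is
polynomial in `k Y`, `d` and `r` for every sequence of examples, because at most `k Y` examples are
ever stored (`wp_learnProg`, `wp_queryProg`, `cost_le`).
-/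

/-! ### Chebyshev approximation of the sigmoid function -/

/-- The sigmoid function on `ℂ`; it is holomorphic on the strip `|Im w| < π`. -/
noncomputable def csigmoid (w : ℂ) : ℂ := (1 + Complex.exp (-w))⁻¹

theorem csigmoid_ofReal (x : ℝ) : csigmoid x = (Real.sigmoid x : ℂ) := by
  simp [csigmoid, Real.sigmoid]

theorem one_le_re_one_add_exp_neg {w : ℂ} (hw : |w.im| ≤ Real.pi / 2) :
    1 ≤ (1 + Complex.exp (-w)).re := by
  have hc : 0 ≤ Real.cos w.im := Real.cos_nonneg_of_mem_Icc ⟨by linarith [(abs_le.mp hw).1],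
    (abs_le.mp hw).2⟩
  have := mul_nonneg (Real.exp_pos (-w.re)).le hc
  simpa [Complex.exp_re] using this

theorem norm_csigmoid_le {w : ℂ} (hw : |w.im| ≤ Real.pi / 2) : ‖csigmoid w‖ ≤ 1 := by
  rw [csigmoid, norm_inv]
  exact inv_le_one_of_one_le₀
    ((one_le_re_one_add_exp_neg hw).trans (Complex.re_le_norm _))

theorem differentiableAt_csigmoid {w : ℂ} (hw : |w.im| ≤ Real.pi / 2) :
    DifferentiableAt ℂ csigmoid w := by
  have h : (1 + Complex.exp (-w)) ≠ 0 := fun h => by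
    have := one_le_re_one_add_exp_neg hw
    rw [h] at this
    norm_num at this
  unfold csigmoid
  fun_prop (disch := exact h)

/-- The complex cosine maps the strip `|Im θ| ≤ 1 / L`, scaled by `L`, into the strip on which the
sigmoid function is bounded by `1`. -/
theorem abs_im_mul_cos_le {L : ℝ} (hL : 1 ≤ L) {θ : ℂ} (hθ : |θ.im| ≤ 1 / L) :
    |((L : ℂ) * Complex.cos θ).im| ≤ Real.pi / 2 := by
  have hL0 : 0 < L := by linarith
  have him : ((L : ℂ) * Complex.cos θ).im = L * -(Real.sin θ.re * Real.sinh θ.im) := by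
    conv_lhs => rw [← Complex.re_add_im θ, Complex.cos_add_mul_I]
    simp [Complex.sin_ofReal_re, Complex.sinh_ofReal_re]
  have h1L : 1 / L ≤ 1 := by rw [div_le_one hL0]; exact hL
  set y := 1 / L with hy
  have hy0 : 0 ≤ y := by positivity
  have hsinh : Real.sinh y ≤ 3 / 2 * y := by
    have h1 := (abs_le.mp (Real.abs_exp_sub_one_sub_id_le (abs_le.mpr ⟨by linarith, h1L⟩))).2
    have h2 := Real.add_one_le_exp (-y)
    rw [Real.sinh_eq]
    nlinarith
  have habs : |Real.sinh θ.im| ≤ 3 / 2 * y := by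
    refine le_trans ?_ hsinh
    rw [Real.abs_sinh]
    exact Real.sinh_le_sinh.mpr hθ
  rw [him, abs_mul, abs_neg, abs_mul, abs_of_pos hL0]
  calc L * (|Real.sin θ.re| * |Real.sinh θ.im|) ≤ L * (1 * (3 / 2 * y)) := by
        gcongr
        exact Real.abs_sin_le_one _
    _ = 3 / 2 := by rw [hy]; field_simp
    _ ≤ Real.pi / 2 := by linarith [Real.pi_gt_three]

/-- Integrals of a `2π`-periodic function over a period do not change when the contour is shifted
vertically within a strip of holomorphy. -/
theorem integral_eq_integral_add_mul_I {H : ℂ → ℂ} {y : ℝ}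
    (hper : ∀ z, H (z + 2 * Real.pi) = H z)
    (hd : ∀ z : ℂ, |z.im| ≤ |y| → DifferentiableAt ℂ H z) :
    ∫ x in (0 : ℝ)..2 * Real.pi, H x = ∫ x in (0 : ℝ)..2 * Real.pi, H (x + y * Complex.I) := by
  have h := Complex.integral_boundary_rect_eq_zero_of_differentiableOn H 0
    ((2 * Real.pi : ℝ) + y * Complex.I) (fun z hz => by
      refine (hd z ?_).differentiableWithinAt
      have hz2 := (Complex.mem_reProdIm.mp hz).2
      simp only [Complex.zero_im, Complex.add_im, Complex.ofReal_im, Complex.mul_im,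
        Complex.ofReal_re, Complex.I_im, Complex.I_re] at hz2
      have := Set.abs_sub_left_of_mem_uIcc hz2
      simpa using this)
  have hside : ∀ t : ℝ, H (((2 * Real.pi : ℝ) : ℂ) + t * Complex.I) = H (t * Complex.I) :=
    fun t => by rw [← hper (t * Complex.I)]; congr 1; push_cast; ring
  simp at h
  have hside' : ∀ t : ℝ, H (2 * Real.pi + t * Complex.I) = H (t * Complex.I) := fun t => by
    simpa using hside t
  simp only [hside'] at h
  linear_combination h

/-- The function `θ ↦ σ (L cos θ)` on the circle. -/
noncomputable def sigmoidCos (L : ℝ) : C(AddCircle (2 * Real.pi), ℂ) where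
  toFun := fun θ => (Real.sigmoid (L * Real.Angle.cos θ) : ℂ)
  continuous_toFun := Complex.continuous_ofReal.comp
    (continuous_sigmoid.comp (continuous_const.mul Real.Angle.continuous_cos))

instance fact_two_pi_pos : Fact (0 < 2 * Real.pi) := ⟨by positivity⟩

/-- Shifting the contour of the Fourier integral by `i y` produces the factor `exp (n y)`, while the
shifted function remains bounded by `1`. -/
theorem norm_fourierCoeff_sigmoidCos_le_exp_mul {L : ℝ} (hL : 1 ≤ L) (n : ℤ) {y : ℝ}
    (hy : |y| ≤ 1 / L) :
    ‖fourierCoeff (sigmoidCos L) n‖ ≤ Real.exp (n * y) := by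
  set H : ℂ → ℂ := fun z => Complex.exp (-(n * z) * Complex.I) * csigmoid (L * Complex.cos z)
    with hH
  have hfc : fourierCoeff (sigmoidCos L) n
      = (1 / (2 * Real.pi)) • ∫ x in (0 : ℝ)..2 * Real.pi, H x := by
    rw [fourierCoeff_eq_intervalIntegral _ n 0, zero_add]
    congr 1
    refine intervalIntegral.integral_congr fun x _ => ?_
    have h1 : (sigmoidCos L) (x : AddCircle (2 * Real.pi)) = csigmoid (L * Complex.cos x) := by
      rw [← Complex.ofReal_cos, ← Complex.ofReal_mul, csigmoid_ofReal]
      rfl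
    have h2 : (fourier (-n)) (x : AddCircle (2 * Real.pi))
        = Complex.exp (-(n * x) * Complex.I) := by
      rw [fourier_coe_apply]
      congr 1
      have : (Real.pi : ℂ) ≠ 0 := by exact_mod_cast Real.pi_ne_zero
      push_cast
      field_simp
    simp only [h1, h2, hH, smul_eq_mul]
  have hshift := integral_eq_integral_add_mul_I (H := H) (y := y)
    (fun z => by
      simp only [hH]
      rw [Complex.cos_add_two_pi]
      congr 1
      rw [show -(n * (z + 2 * Real.pi)) * Complex.I
        = -(n * z) * Complex.I - n * (2 * Real.pi * Complex.I) by ring]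
      exact Complex.exp_periodic.sub_int_mul_eq n)
    (fun z hz => by
      have := differentiableAt_csigmoid (abs_im_mul_cos_le hL (hz.trans hy))
      have h2 : DifferentiableAt ℂ (csigmoid ∘ fun z => L * Complex.cos z) z :=
        this.comp z (by fun_prop)
      exact DifferentiableAt.mul (by fun_prop) h2)
  rw [hfc, hshift, norm_smul]
  have hbound : ‖∫ x in (0 : ℝ)..2 * Real.pi, H (x + y * Complex.I)‖
      ≤ Real.exp (n * y) * |2 * Real.pi - 0| := by
    refine intervalIntegral.norm_integral_le_of_norm_le_const fun x _ => ?_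
    have h1 : ‖csigmoid (L * Complex.cos (x + y * Complex.I))‖ ≤ 1 :=
      norm_csigmoid_le (abs_im_mul_cos_le hL (by simpa using hy))
    have h2 : ‖Complex.exp (-(n * (x + y * Complex.I)) * Complex.I)‖ = Real.exp (n * y) := by
      rw [Complex.norm_exp]
      simp
    simp only [hH]
    rw [norm_mul, h2]
    exact mul_le_of_le_one_right (Real.exp_pos _).le h1
  have hpi : 0 < 2 * Real.pi := by positivity
  rw [sub_zero, abs_of_pos hpi] at hbound
  rw [Real.norm_of_nonneg (by positivity), one_div, inv_mul_le_iff₀ hpi]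
  linarith

theorem norm_fourierCoeff_sigmoidCos_le {L : ℝ} (hL : 1 ≤ L) (n : ℤ) :
    ‖fourierCoeff (sigmoidCos L) n‖ ≤ Real.exp (-(1 / L)) ^ n.natAbs := by
  have hL0 : 0 < 1 / L := by positivity
  rw [← Real.exp_nat_mul]
  rcases le_total 0 n with hn | hn
  · refine (norm_fourierCoeff_sigmoidCos_le_exp_mul hL n (y := -(1 / L))
      (by rw [abs_neg, abs_of_pos hL0])).trans_eq ?_
    rw [Nat.cast_natAbs, abs_of_nonneg hn]
  · refine (norm_fourierCoeff_sigmoidCos_le_exp_mul hL n (y := 1 / L)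
      (by rw [abs_of_pos hL0])).trans_eq ?_
    rw [Nat.cast_natAbs, abs_of_nonpos hn]
    push_cast
    ring_nf

/-- The Chebyshev series of the sigmoid function on `[-L, L]`, in trigonometric form and indexed by
the integers. -/
theorem exists_hasSum_cos_sigmoid {L : ℝ} (hL : 1 ≤ L) :
    ∃ c : ℤ → ℝ, (∀ n, |c n| ≤ Real.exp (-(1 / L)) ^ n.natAbs) ∧
      ∀ t : ℝ, HasSum (fun n : ℤ => c n * Real.cos (n * t)) (Real.sigmoid (L * Real.cos t)) := by
  have hq : Real.exp (-(1 / L)) < 1 := by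
    rw [Real.exp_lt_one_iff]
    have : 0 < 1 / L := by positivity
    linarith
  have hsumm : Summable (fourierCoeff (sigmoidCos L)) := by
    refine Summable.of_norm_bounded (g := fun n : ℤ => Real.exp (-(1 / L)) ^ n.natAbs) ?_
      (norm_fourierCoeff_sigmoidCos_le hL)
    have := summable_geometric_of_lt_one (Real.exp_pos _).le hq
    exact Summable.of_nat_of_neg (by simpa using this) (by simpa using this)
  have hs : ∀ t : ℝ, HasSum (fun n : ℤ => fourierCoeff (sigmoidCos L) n *
      Complex.exp (n * t * Complex.I)) (Real.sigmoid (L * Real.cos t) : ℂ) := fun t => by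
    have h := has_pointwise_sum_fourier_series_of_summable hsumm (t : AddCircle (2 * Real.pi))
    rw [show (sigmoidCos L) (t : AddCircle (2 * Real.pi)) = (Real.sigmoid (L * Real.cos t) : ℂ)
      from rfl] at h
    convert h using 2 with n
    rw [fourier_coe_apply, smul_eq_mul]
    congr 2
    have : (Real.pi : ℂ) ≠ 0 := by exact_mod_cast Real.pi_ne_zero
    push_cast
    field_simp
  refine ⟨fun n => (fourierCoeff (sigmoidCos L) n).re, fun n =>
    (Complex.abs_re_le_norm _).trans (norm_fourierCoeff_sigmoidCos_le hL n), fun t => ?_⟩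
  -- averaging over `t` and `-t` turns the exponentials into cosines
  have h := ((hs t).add (hs (-t))).mul_left (1 / 2 : ℂ)
  have h2 := Complex.hasSum_re h
  convert h2 using 1
  · funext n
    have : (1 / 2 : ℂ) * (fourierCoeff (sigmoidCos L) n * Complex.exp (n * t * Complex.I)
        + fourierCoeff (sigmoidCos L) n * Complex.exp (n * (-t : ℝ) * Complex.I))
        = fourierCoeff (sigmoidCos L) n * (Real.cos (n * t) : ℝ) := by
      push_cast [Complex.cos]
      ring_nf
    rw [this, Complex.re_mul_ofReal]
  · rw [Real.cos_neg, ← Complex.ofReal_add,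
      show (1 / 2 : ℂ) = ((1 / 2 : ℝ) : ℂ) by push_cast; rfl, ← Complex.ofReal_mul,
      Complex.ofReal_re]
    ring

/-- Truncating the Chebyshev series of the sigmoid function on `[-L, L]` at degree `r` leaves an
error that decays like `exp (-r / L)`, while all coefficients stay bounded. -/
theorem exists_chebyshev_sigmoid_approx {L : ℝ} (hL : 1 ≤ L) (r : ℕ) :
    ∃ (a : ℕ → ℝ) (b : ℝ), (∀ n, |a n| ≤ 2) ∧ |b| ≤ 1 ∧ ∀ z, |z| ≤ 1 →
      |∑ n ∈ Finset.range r, a n * (Polynomial.Chebyshev.T ℝ n).eval z + b - Real.sigmoid (L * z)|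
        ≤ 4 * L * Real.exp (-(r / L)) := by
  obtain ⟨c, hc, hs⟩ := exists_hasSum_cos_sigmoid hL
  have hL0 : 0 < 1 / L := by positivity
  have h1L : 1 / L ≤ 1 := by rw [div_le_one (by linarith)]; exact hL
  set q := Real.exp (-(1 / L)) with hqdef
  have hq0 : 0 < q := Real.exp_pos _
  have hq : 1 / (2 * L) ≤ 1 - q := by
    have h1 := (abs_le.mp (Real.abs_exp_sub_one_sub_id_le (x := 1 / L)
      (abs_le.mpr ⟨by linarith, h1L⟩))).2
    have h2 := Real.add_one_le_exp (1 / L)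
    have h3 : q * Real.exp (1 / L) = 1 := by rw [hqdef, ← Real.exp_add]; simp
    have h4 : 1 / (2 * L) = (1 / L) / 2 := by field_simp
    rw [h4]
    nlinarith
  have hq1 : q < 1 := by
    have : 0 < 1 / (2 * L) := by positivity
    linarith
  refine ⟨fun n => c n + c (-n), -c 0, fun n => ?_, ?_, fun z hz => ?_⟩
  · have h1 := hc n
    have h2 := hc (-n)
    have h3 : q ^ n ≤ 1 := pow_le_one₀ hq0.le hq1.le
    simp only [Int.natAbs_neg, Int.natAbs_natCast] at h1 h2
    calc |c n + c (-n)| ≤ |c n| + |c (-n)| := abs_add_le _ _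
      _ ≤ 2 := by linarith
  · simpa using hc 0
  · obtain ⟨hz1, hz2⟩ := abs_le.mp hz
    have hcos := Real.cos_arccos hz1 hz2
    set t := Real.arccos z
    have h := (hs t).nat_add_neg
    have hb := norm_sub_le_of_geometric_bound_of_hasSum (C := 2) hq1 (fun n => by
      have h1 := hc n
      have h2 := hc (-n)
      simp only [Int.natAbs_neg, Int.natAbs_natCast] at h1 h2
      have h3 := Real.abs_cos_le_one ((n : ℤ) * t)
      have h4 : (c n * Real.cos ((n : ℤ) * t) + c (-n) * Real.cos ((-(n : ℤ) : ℤ) * t))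
          = (c n + c (-n)) * Real.cos ((n : ℤ) * t) := by
        rw [Int.cast_neg, neg_mul, Real.cos_neg]; ring
      rw [h4, Real.norm_eq_abs, abs_mul]
      calc |c n + c (-n)| * |Real.cos ((n : ℤ) * t)| ≤ (|c n| + |c (-n)|) * 1 := by
            gcongr
            exact abs_add_le _ _
        _ ≤ 2 * q ^ n := by linarith) h r
    rw [Real.norm_eq_abs] at hb
    have heq : ∑ n ∈ Finset.range r, (c n + c (-n)) * (Polynomial.Chebyshev.T ℝ n).eval z + -c 0
        - Real.sigmoid (L * z) = ∑ n ∈ Finset.range r, (c n * Real.cos ((n : ℤ) * t)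
          + c (-n) * Real.cos ((-(n : ℤ) : ℤ) * t))
          - (Real.sigmoid (L * Real.cos t) + c 0 * Real.cos ((0 : ℤ) * t)) := by
      rw [hcos]
      have : ∑ n ∈ Finset.range r, (c n + c (-n)) * (Polynomial.Chebyshev.T ℝ n).eval z
          = ∑ n ∈ Finset.range r, (c n * Real.cos ((n : ℤ) * t)
          + c (-n) * Real.cos ((-(n : ℤ) : ℤ) * t)) := by
        refine Finset.sum_congr rfl fun n _ => ?_
        rw [← hcos, Polynomial.Chebyshev.T_real_cos, Int.cast_neg, neg_mul, Real.cos_neg]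
        ring
      rw [this]
      simp
      ring
    rw [heq]
    refine hb.trans ?_
    have hqr : q ^ r = Real.exp (-(r / L)) := by
      rw [hqdef, ← Real.exp_nat_mul]; congr 1; ring
    rw [hqr, div_le_iff₀ (by linarith)]
    have : 4 * L * Real.exp (-(r / L)) * (1 / (2 * L)) = 2 * Real.exp (-(r / L)) := by
      field_simp; ring
    rw [← this]
    gcongr

/-! ### Polynomials on the cube with few large coefficients -/

/-- The coordinates of a point of the cube, with an additional coordinate `none` that is always
`1`. -/
def Cube.ext {d : ℕ} (x : Cube d) : Option (Fin d) → ℝ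
  | none => 1
  | some i => x.toReal i

/-- The monomial of degree at most `r` that multiplies the coordinates `α 0, …, α (r - 1)`. The
constant coordinate `none` pads monomials of smaller degree; different `α` may give the same
monomial. -/
def Cube.monomial {d r : ℕ} (x : Cube d) (α : Fin r → Option (Fin d)) : ℝ := ∏ j, x.ext (α j)

/-- `PolyRep r g B`: on the cube, `g` is a polynomial of degree at most `r` whose coefficients have
`ℓ₁`-norm at most `B`. -/
def PolyRep {d : ℕ} (r : ℕ) (g : Cube d → ℝ) (B : ℝ) : Prop :=
  ∃ w : (Fin r → Option (Fin d)) → ℝ, ∑ α, |w α| ≤ B ∧ ∀ x, g x = ∑ α, w α * x.monomial α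

namespace PolyRep

variable {d r : ℕ} {g g' : Cube d → ℝ} {B B' : ℝ}

theorem mono (h : PolyRep r g B) (hB : B ≤ B') : PolyRep r g B' := by
  obtain ⟨w, hw, hg⟩ := h
  exact ⟨w, hw.trans hB, hg⟩

theorem add (h : PolyRep r g B) (h' : PolyRep r g' B') :
    PolyRep r (fun x => g x + g' x) (B + B') := by
  obtain ⟨w, hw, hg⟩ := h
  obtain ⟨w', hw', hg'⟩ := h'
  refine ⟨fun α => w α + w' α, ?_, fun x => ?_⟩
  · calc ∑ α, |w α + w' α| ≤ ∑ α, (|w α| + |w' α|) := Finset.sum_le_sum fun α _ => abs_add_le _ _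
      _ ≤ B + B' := by rw [Finset.sum_add_distrib]; linarith
  · simp only [hg, hg', ← Finset.sum_add_distrib]
    exact Finset.sum_congr rfl fun α _ => by ring

theorem const_mul (h : PolyRep r g B) (c : ℝ) : PolyRep r (fun x => c * g x) (|c| * B) := by
  obtain ⟨w, hw, hg⟩ := h
  refine ⟨fun α => c * w α, ?_, fun x => ?_⟩
  · simp only [abs_mul, ← Finset.mul_sum]
    gcongr
  · simp only [hg, Finset.mul_sum]
    exact Finset.sum_congr rfl fun α _ => by ring

theorem zero : PolyRep r (fun _ : Cube d => 0) 0 := ⟨fun _ => 0, by simp, by simp⟩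

theorem sum {ι : Type*} (s : Finset ι) {g : ι → Cube d → ℝ} {B : ι → ℝ}
    (h : ∀ i ∈ s, PolyRep r (g i) (B i)) : PolyRep r (fun x => ∑ i ∈ s, g i x) (∑ i ∈ s, B i) := by
  classical
  induction s using Finset.induction_on with
  | empty => simpa using zero
  | insert i s hi ih =>
    simp only [Finset.sum_insert hi]
    exact (h i (Finset.mem_insert_self _ _)).add
      (ih fun j hj => h j (Finset.mem_insert_of_mem hj))

theorem const_zero (c : ℝ) : PolyRep 0 (fun _ : Cube d => c) |c| :=
  ⟨fun _ => c, by simp, by simp [Cube.monomial]⟩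

theorem affine_mul (h : PolyRep r g B) (v : Fin d → ℝ) (b : ℝ) :
    PolyRep (r + 1) (fun x => (∑ i, v i * x.toReal i + b) * g x) ((∑ i, |v i| + |b|) * B) := by
  obtain ⟨w, hw, hg⟩ := h
  set v' : Option (Fin d) → ℝ := fun o => o.elim b v with hv'
  have key : ∀ F : (Fin (r + 1) → Option (Fin d)) → ℝ,
      ∑ α, F α = ∑ o, ∑ β : Fin r → Option (Fin d), F (Fin.cons o β) := fun F => by
    rw [← Fintype.sum_prod_type', ← (Fin.consEquiv (fun _ => Option (Fin d))).sum_comp]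
    rfl
  refine ⟨fun α => v' (α 0) * w (Fin.tail α), ?_, fun x => ?_⟩
  · rw [key]
    simp only [Fin.cons_zero, Fin.tail_cons, abs_mul, ← Finset.mul_sum]
    rw [← Finset.sum_mul]
    have : ∑ o, |v' o| = ∑ i, |v i| + |b| := by
      rw [Fintype.sum_option, add_comm]; rfl
    rw [this]
    gcongr
  · rw [key]
    beta_reduce
    rw [hg]
    have : ∑ i, v i * x.toReal i + b = ∑ o, v' o * x.ext o := by
      rw [Fintype.sum_option, add_comm]; simp [hv', Cube.ext]
    rw [this, Finset.sum_mul_sum]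
    refine Finset.sum_congr rfl fun o _ => Finset.sum_congr rfl fun β _ => ?_
    simp only [Fin.cons_zero, Fin.tail_cons, Cube.monomial, Fin.prod_univ_succ, Fin.cons_succ]
    ring

theorem succ (h : PolyRep r g B) : PolyRep (r + 1) g B := by
  simpa using h.affine_mul 0 1

theorem of_le {r' : ℕ} (h : PolyRep r g B) (hr : r ≤ r') : PolyRep r' g B := by
  induction r', hr using Nat.le_induction with
  | base => exact h
  | succ n _ ih => exact ih.succ

theorem const (c : ℝ) : PolyRep r (fun _ : Cube d => c) |c| := (const_zero c).of_le r.zero_le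

end PolyRep

/-- The three-term recursion bounds the coefficients of the Chebyshev polynomial of an affine form
of `ℓ₁`-norm at most `1`. -/
theorem PolyRep.chebyshev {d : ℕ} (v : Fin d → ℝ) (b : ℝ) (h : ∑ i, |v i| + |b| ≤ 1) (n : ℕ) :
    PolyRep n (fun x : Cube d =>
      (Polynomial.Chebyshev.T ℝ n).eval (∑ i, v i * x.toReal i + b)) (3 ^ n) := by
  induction n using Nat.twoStepInduction with
  | zero => simpa using PolyRep.const_zero (d := d) 1
  | one =>
    have := ((PolyRep.const_zero (d := d) 1).affine_mul v b).mono (B' := 3 ^ 1)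
      (by rw [abs_one, mul_one]; linarith)
    simpa using this
  | more n ih0 ih1 =>
    have h1 := (ih1.affine_mul v b).const_mul 2
    have h2 := (ih0.succ.succ).const_mul (-1)
    have h3 := (h1.add h2).mono (B' := 3 ^ (n + 2)) (by
      have h4 : (0 : ℝ) < 3 ^ n := by positivity
      have h5 : (∑ i, |v i| + |b|) * (3 : ℝ) ^ (n + 1) ≤ 1 * 3 ^ (n + 1) := by gcongr
      rw [abs_two, abs_neg, abs_one]
      have h6 : (3 : ℝ) ^ (n + 1) = 3 * 3 ^ n := pow_succ' _ _
      have h7 : (3 : ℝ) ^ (n + 2) = 9 * 3 ^ n := by ring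
      rw [h6] at h5 ⊢
      rw [h7]
      linarith)
    convert h3 using 2 with x
    rw [Nat.cast_add, Nat.cast_ofNat, Polynomial.Chebyshev.T_add_two]
    simp only [Polynomial.eval_sub, Polynomial.eval_mul, Polynomial.eval_ofNat, Polynomial.eval_X,
      Nat.cast_add, Nat.cast_one]
    ring

/-- A sigmoid network of depth two is uniformly `1/2`-close on the cube to a polynomial of degree
`r ≈ L ln L`, with coefficients of size exponential in `r` only. -/
theorem exists_polyRep_of_mem_netClass {d n r : ℕ} {L : ℝ} (hL : 1 ≤ L)
    (hr : 4 * L * Real.exp (-(r / L)) ≤ 1 / (2 * L)) {f : (Fin d → ℝ) → ℝ}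
    (hf : f ∈ NetClass d 2 n Real.sigmoid L) :
    ∃ g : Cube d → ℝ, PolyRep r g (2 * L * 3 ^ r) ∧ ∀ x : Cube d, |g x - f x.toReal| ≤ 1 / 2 := by
  have hL0 : 0 < L := by linarith
  obtain ⟨F, hF, hfF⟩ := hf
  obtain ⟨n₀, m, -, G, ⟨-, V, c, hVc, hG⟩, W, b, hWb, hFG⟩ := hF
  obtain ⟨a, a', ha, ha', happ⟩ := exists_chebyshev_sigmoid_approx hL r
  have hV : ∀ j, ∑ i, |V j i / L| + |c j / L| ≤ 1 := fun j => by
    simp only [abs_div, abs_of_pos hL0, ← Finset.sum_div]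
    rw [← add_div, div_le_one hL0]
    exact hVc j
  -- the approximation of the output of the `j`-th hidden neuron
  set p : Fin m → Cube d → ℝ := fun j x => ∑ k ∈ Finset.range r, a k *
    (Polynomial.Chebyshev.T ℝ k).eval (∑ i, V j i / L * x.toReal i + c j / L) + a' with hp
  have hpRep : ∀ j, PolyRep r (p j) (3 ^ r) := fun j => by
    refine PolyRep.mono (B := ∑ k ∈ Finset.range r, 2 * 3 ^ k + 1) ?_ ?_
    · refine PolyRep.add (PolyRep.sum _ fun k hk => ?_) ((PolyRep.const a').mono ha')
      refine ((PolyRep.chebyshev (V j · / L) (c j / L) (hV j) k).of_le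
        (Finset.mem_range.mp hk).le |>.const_mul (a k)).mono ?_
      gcongr
      exact ha k
    · rw [← Finset.mul_sum, geom_sum_eq (by norm_num)]
      apply le_of_eq
      ring
  have hpapp : ∀ j x, |p j x - Real.sigmoid (G x.toReal j)| ≤ 1 / (2 * L) := fun j x => by
    have hx : |∑ i, V j i / L * x.toReal i + c j / L| ≤ 1 := by
      refine le_trans ?_ (hV j)
      refine (abs_add_le _ _).trans ?_
      gcongr
      refine (Finset.abs_sum_le_sum_abs _ _).trans (Finset.sum_le_sum fun i _ => ?_)
      rw [abs_mul]
      refine mul_le_of_le_one_right (abs_nonneg _) ?_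
      simp only [Cube.toReal]
      split <;> simp
    have := (happ _ hx).trans hr
    have hz : L * (∑ i, V j i / L * x.toReal i + c j / L) = G x.toReal j := by
      rw [hG, mul_add, Finset.mul_sum]
      congr 1
      · exact Finset.sum_congr rfl fun i _ => by field_simp
      · field_simp
    rwa [hz] at this
  have hW := hWb 0
  have hW1 : ∑ j, |W 0 j| ≤ L := by linarith [abs_nonneg (b 0)]
  have hb1 : |b 0| ≤ L := by
    have : 0 ≤ ∑ j, |W 0 j| := Finset.sum_nonneg fun _ _ => abs_nonneg _
    linarith
  refine ⟨fun x => ∑ j, W 0 j * p j x + b 0, ?_, fun x => ?_⟩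
  · refine ((PolyRep.sum Finset.univ fun j _ => (hpRep j).const_mul (W 0 j)).add
      (PolyRep.const (b 0))).mono ?_
    rw [← Finset.sum_mul]
    have h3 : (1 : ℝ) ≤ 3 ^ r := one_le_pow₀ (by norm_num)
    calc (∑ j, |W 0 j|) * 3 ^ r + |b 0| ≤ L * 3 ^ r + L * 3 ^ r := by
          gcongr
          exact hb1.trans (le_mul_of_one_le_right hL0.le h3)
      _ = 2 * L * 3 ^ r := by ring
  · rw [hfF, hFG]
    have : ∑ j, W 0 j * p j x + b 0 - (∑ j, W 0 j * Real.sigmoid (G x.toReal j) + b 0)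
        = ∑ j, W 0 j * (p j x - Real.sigmoid (G x.toReal j)) := by
      simp only [mul_sub, Finset.sum_sub_distrib]
      ring
    rw [this]
    calc |∑ j, W 0 j * (p j x - Real.sigmoid (G x.toReal j))|
        ≤ ∑ j, |W 0 j| * (1 / (2 * L)) := by
          refine (Finset.abs_sum_le_sum_abs _ _).trans (Finset.sum_le_sum fun j _ => ?_)
          rw [abs_mul]
          gcongr
          exact hpapp j x
      _ ≤ L * (1 / (2 * L)) := by rw [← Finset.sum_mul]; gcongr
      _ = 1 / 2 := by field_simp

theorem abs_le_of_mem_netClass {d n : ℕ} {L : ℝ} {f : (Fin d → ℝ) → ℝ}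
    (hf : f ∈ NetClass d 2 n Real.sigmoid L) (x : Fin d → ℝ) : |f x| ≤ L := by
  obtain ⟨F, hF, hfF⟩ := hf
  obtain ⟨n₀, m, -, G, -, W, b, hWb, hFG⟩ := hF
  rw [hfF, hFG]
  refine le_trans ((abs_add_le _ _).trans ?_) (hWb 0)
  gcongr
  refine (Finset.abs_sum_le_sum_abs _ _).trans (Finset.sum_le_sum fun j _ => ?_)
  rw [abs_mul, abs_of_pos (Real.sigmoid_pos _)]
  exact mul_le_of_le_one_right (abs_nonneg _) (Real.sigmoid_le_one _)

/-- On the one-dimensional cube every sign pattern is that of a linear polynomial with small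
coefficients. -/
theorem exists_polyRep_one (y : Cube 1 → ℝ) (hy : ∀ x, |y x| ≤ 1) :
    PolyRep 1 y 3 := by
  set u := y fun _ => false with hu
  set v := y fun _ => true with hv
  have h1 : |u| ≤ 1 := hy _
  have h2 : |v| ≤ 1 := hy _
  have h := ((PolyRep.const_zero (d := 1) 1).affine_mul (fun _ => v - u) u).mono (B' := 3) (by
    have := abs_sub v u
    simp
    linarith)
  convert h using 2 with x
  have hx : x = fun _ => x 0 := funext fun i => by rw [Subsingleton.elim i 0]
  rw [hx]
  cases x 0 <;> simp [Cube.toReal, hu, hv]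

/-! ### The kernel perceptron -/

/-- The number of common ones of two points of the cube. -/
def Cube.dot {d : ℕ} (z x : Cube d) : ℤ := ∑ j ∈ Finset.range d, z.get j * x.get j

/-- The sign with which an example enters the kernel sum. -/
def exampleSign {d : ℕ} (e : Cube d × SignType) : ℤ := if 0 < e.2 then 1 else -1

/-- The value at `x` of the kernel perceptron with kernel `(z, x) ↦ (1 + ⟨z, x⟩) ^ r` that has made
mistakes on the examples in `l`. -/
def kernelSum {d : ℕ} (r : ℕ) (l : List (Cube d × SignType)) (x : Cube d) : ℤ :=
  (l.map fun e => exampleSign e * (1 + e.1.dot x) ^ r).sum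

theorem Cube.get_coe {d : ℕ} (x : Cube d) (i : Fin d) : x.get (i : ℕ) = if x i then 1 else 0 := by
  simp [Cube.get]

theorem Cube.one_add_dot_pow {d : ℕ} (r : ℕ) (z x : Cube d) :
    (((1 + z.dot x) ^ r : ℤ) : ℝ) = ∑ α : Fin r → Option (Fin d), z.monomial α * x.monomial α := by
  have h : ((1 + z.dot x : ℤ) : ℝ) = ∑ o, z.ext o * x.ext o := by
    rw [Fintype.sum_option, Cube.dot, Finset.sum_range]
    push_cast
    simp only [Cube.ext, one_mul]
    congr 1
    refine Finset.sum_congr rfl fun i _ => ?_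
    rw [Cube.get_coe, Cube.get_coe, Cube.toReal, Cube.toReal]
    push_cast
    rfl
  rw [Int.cast_pow, h, Fintype.sum_pow]
  simp only [Cube.monomial, Finset.prod_mul_distrib]

theorem Cube.one_add_dot_self_pow_le {d : ℕ} (r : ℕ) (x : Cube d) :
    ((1 + x.dot x) ^ r : ℤ) ≤ ((d : ℤ) + 1) ^ r := by
  have h0 : ∀ j : ℤ, 0 ≤ x.get j ∧ x.get j ≤ 1 := fun j => by
    unfold Cube.get; split
    · split <;> simp
    · simp
  have h1 : x.dot x ≤ d := by
    calc x.dot x ≤ ∑ j ∈ Finset.range d, 1 := Finset.sum_le_sum fun j _ => by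
          nlinarith [h0 j]
      _ = d := by simp
  have h2 : 0 ≤ x.dot x := Finset.sum_nonneg fun j _ => mul_self_nonneg _
  exact pow_le_pow_left₀ (by linarith) (by linarith) r

/-- The weight vector, in the space of monomials, that belongs to the kernel sum of `l`. -/
noncomputable def weightVector {d : ℕ} (r : ℕ) (l : List (Cube d × SignType))
    (α : Fin r → Option (Fin d)) : ℝ :=
  (l.map fun e => (exampleSign e : ℝ) * e.1.monomial α).sum

theorem kernelSum_eq {d : ℕ} (r : ℕ) (l : List (Cube d × SignType)) (x : Cube d) :
    (kernelSum r l x : ℝ) = ∑ α, weightVector r l α * x.monomial α := by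
  induction l with
  | nil => simp [kernelSum, weightVector]
  | cons e l ih =>
    simp only [kernelSum, weightVector, List.map_cons, List.sum_cons, add_mul,
      Finset.sum_add_distrib] at ih ⊢
    rw [Int.cast_add, ih, Int.cast_mul, Cube.one_add_dot_pow, Finset.mul_sum]
    simp only [mul_assoc]

/-- The two sides of the analysis of the perceptron: the squared norm of the weight vector grows at
most linearly in the number of mistakes, and so does, from below, its inner product with the weights
`w` of a separating polynomial. -/
def PerceptronInv {d : ℕ} (r : ℕ) (w : (Fin r → Option (Fin d)) → ℝ)
    (l : List (Cube d × SignType)) : Prop :=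
  ∑ α, weightVector r l α ^ 2 ≤ l.length * ((d : ℝ) + 1) ^ r ∧
    l.length * (1 / 2 : ℝ) ≤ ∑ α, weightVector r l α * w α

theorem PerceptronInv.nil {d r : ℕ} (w : (Fin r → Option (Fin d)) → ℝ) : PerceptronInv r w [] := by
  simp [PerceptronInv, weightVector]

theorem PerceptronInv.append {d r : ℕ} {w : (Fin r → Option (Fin d)) → ℝ}
    {l : List (Cube d × SignType)} (h : PerceptronInv r w l) {e : Cube d × SignType}
    (hmistake : ¬ (0 < kernelSum r l e.1 ↔ 0 < e.2))
    (hmargin : 1 / 2 ≤ (exampleSign e : ℝ) * ∑ α, w α * e.1.monomial α) :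
    PerceptronInv r w (l ++ [e]) := by
  obtain ⟨h1, h2⟩ := h
  have hv : ∀ α, weightVector r (l ++ [e]) α
      = weightVector r l α + (exampleSign e : ℝ) * e.1.monomial α := fun α => by
    simp [weightVector]
  have hs : (exampleSign e : ℝ) ^ 2 = 1 := by
    unfold exampleSign; split <;> simp
  have hcorr : (exampleSign e : ℝ) * ∑ α, weightVector r l α * e.1.monomial α ≤ 0 := by
    rw [← kernelSum_eq]
    have : exampleSign e * kernelSum r l e.1 ≤ 0 := by
      unfold exampleSign
      by_cases hy : 0 < e.2
      · rw [if_pos hy]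
        have : ¬ 0 < kernelSum r l e.1 := fun h => hmistake ⟨fun _ => hy, fun _ => h⟩
        linarith
      · rw [if_neg hy]
        have : 0 < kernelSum r l e.1 := by
          by_contra h
          exact hmistake ⟨fun h' => absurd h' h, fun h' => absurd h' hy⟩
        linarith
    exact_mod_cast this
  have hnorm : ∑ α : Fin r → Option (Fin d), e.1.monomial α ^ 2 ≤ ((d : ℝ) + 1) ^ r := by
    simp only [pow_two]
    rw [← Cube.one_add_dot_pow]
    exact_mod_cast Cube.one_add_dot_self_pow_le r e.1
  constructor
  · have : ∑ α, weightVector r (l ++ [e]) α ^ 2 = ∑ α, weightVector r l α ^ 2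
        + 2 * ((exampleSign e : ℝ) * ∑ α, weightVector r l α * e.1.monomial α)
        + ∑ α : Fin r → Option (Fin d), e.1.monomial α ^ 2 := by
      rw [Finset.mul_sum, Finset.mul_sum, ← Finset.sum_add_distrib, ← Finset.sum_add_distrib]
      refine Finset.sum_congr rfl fun α _ => ?_
      rw [hv]
      linear_combination (e.1.monomial α) ^ 2 * hs
    rw [this, List.length_append, List.length_singleton]
    push_cast
    linarith
  · have : ∑ α, weightVector r (l ++ [e]) α * w α = ∑ α, weightVector r l α * w α
        + (exampleSign e : ℝ) * ∑ α, w α * e.1.monomial α := by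
      rw [Finset.mul_sum, ← Finset.sum_add_distrib]
      exact Finset.sum_congr rfl fun α _ => by rw [hv]; ring
    rw [this, List.length_append, List.length_singleton]
    push_cast
    linarith

/-- The mistake bound of the perceptron. -/
theorem PerceptronInv.length_le {d r : ℕ} {w : (Fin r → Option (Fin d)) → ℝ} {B : ℝ}
    (hw : ∑ α, |w α| ≤ B) {l : List (Cube d × SignType)} (h : PerceptronInv r w l) :
    (l.length : ℝ) ≤ 4 * B ^ 2 * ((d : ℝ) + 1) ^ r := by
  obtain ⟨h1, h2⟩ := h
  have hB : ∑ α, w α ^ 2 ≤ B ^ 2 := by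
    calc ∑ α, w α ^ 2 = ∑ α, |w α| ^ 2 := by simp
      _ ≤ (∑ α, |w α|) ^ 2 := Finset.sum_sq_le_sq_sum_of_nonneg fun _ _ => abs_nonneg _
      _ ≤ B ^ 2 := by gcongr
  have hcs := Finset.sum_mul_sq_le_sq_mul_sq Finset.univ (weightVector r l) w
  rcases Nat.eq_zero_or_pos l.length with h0 | h0
  · rw [h0, Nat.cast_zero]; positivity
  · have h0' : (0 : ℝ) < l.length := by exact_mod_cast h0
    have h3 : ((l.length : ℝ) * (1 / 2)) ^ 2 ≤ l.length * ((d : ℝ) + 1) ^ r * B ^ 2 := by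
      calc ((l.length : ℝ) * (1 / 2)) ^ 2 ≤ (∑ α, weightVector r l α * w α) ^ 2 := by gcongr
        _ ≤ _ := hcs
        _ ≤ _ := by gcongr
    have h4 : (l.length : ℝ) * l.length ≤ l.length * (4 * B ^ 2 * ((d : ℝ) + 1) ^ r) := by
      nlinarith
    exact le_of_mul_le_mul_left h4 h0'

/-! ### Weakest preconditions of machine programs -/

/-- The program `A` started in `s` halts, and the number of steps and the final state
satisfy `Q`. -/
def WP {d : ℕ} (S : ℕ → Cube d × SignType) (A : Cmd) (Q : ℕ → MState → Prop) (s : MState) : Prop :=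
  ∃ τ s', Exec S A s τ s' ∧ Q τ s'

section

variable {d : ℕ} {S : ℕ → Cube d × SignType} {Q : ℕ → MState → Prop} {s : MState}

theorem WP.mono {A : Cmd} {Q' : ℕ → MState → Prop} (h : WP S A Q s)
    (hQ : ∀ τ s', Q τ s' → Q' τ s') : WP S A Q' s := by
  obtain ⟨τ, s', h1, h2⟩ := h
  exact ⟨τ, s', h1, hQ _ _ h2⟩

theorem wp_skip : WP S .skip Q s ↔ Q 1 s :=
  ⟨fun ⟨_, _, h, hQ⟩ => by cases h; exact hQ, fun h => ⟨_, _, .skip _, h⟩⟩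

theorem wp_const {r : ℕ} {z : ℤ} : WP S (.const r z) Q s ↔ Q 1 (s.setReg r z) :=
  ⟨fun ⟨_, _, h, hQ⟩ => by cases h; exact hQ, fun h => ⟨_, _, .const _ _ _, h⟩⟩

theorem wp_add {r p q : ℕ} : WP S (.add r p q) Q s ↔ Q 1 (s.setReg r (s.reg p + s.reg q)) :=
  ⟨fun ⟨_, _, h, hQ⟩ => by cases h; exact hQ, fun h => ⟨_, _, .add _ _ _ _, h⟩⟩

theorem wp_sub {r p q : ℕ} : WP S (.sub r p q) Q s ↔ Q 1 (s.setReg r (s.reg p - s.reg q)) :=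
  ⟨fun ⟨_, _, h, hQ⟩ => by cases h; exact hQ, fun h => ⟨_, _, .sub _ _ _ _, h⟩⟩

theorem wp_load {r p : ℕ} : WP S (.load r p) Q s ↔ Q 1 (s.setReg r (s.mem (s.reg p))) :=
  ⟨fun ⟨_, _, h, hQ⟩ => by cases h; exact hQ, fun h => ⟨_, _, .load _ _ _, h⟩⟩

theorem wp_store {p q : ℕ} : WP S (.store p q) Q s ↔ Q 1 (s.setMem (s.reg p) (s.reg q)) :=
  ⟨fun ⟨_, _, h, hQ⟩ => by cases h; exact hQ, fun h => ⟨_, _, .store _ _ _, h⟩⟩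

theorem wp_coord {r p : ℕ} :
    WP S (.coord r p) Q s ↔ Q 1 (s.setReg r ((S s.pos).1.get (s.reg p))) :=
  ⟨fun ⟨_, _, h, hQ⟩ => by cases h; exact hQ, fun h => ⟨_, _, .coord _ _ _, h⟩⟩

theorem wp_label {r : ℕ} : WP S (.label r) Q s ↔ Q 1 (s.setReg r ((S s.pos).2 : ℤ)) :=
  ⟨fun ⟨_, _, h, hQ⟩ => by cases h; exact hQ, fun h => ⟨_, _, .label _ _, h⟩⟩

theorem wp_advance : WP S .advance Q s ↔ Q 1 s.nextExample :=
  ⟨fun ⟨_, _, h, hQ⟩ => by cases h; exact hQ, fun h => ⟨_, _, .advance _, h⟩⟩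

theorem wp_seq {A B : Cmd} :
    WP S (.seq A B) Q s ↔ WP S A (fun τ s' => WP S B (fun τ' s'' => Q (τ + τ') s'') s') s := by
  constructor
  · rintro ⟨_, _, h, hQ⟩
    cases h with
    | seq hA hB => exact ⟨_, _, hA, _, _, hB, hQ⟩
  · rintro ⟨_, _, hA, _, _, hB, hQ⟩
    exact ⟨_, _, .seq hA hB, hQ⟩

theorem wp_cond {r : ℕ} {A B : Cmd} :
    WP S (.cond r A B) Q s ↔ if 0 < s.reg r then WP S A (fun τ s' => Q (τ + 1) s') s
      else WP S B (fun τ s' => Q (τ + 1) s') s := by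
  constructor
  · rintro ⟨_, _, h, hQ⟩
    cases h with
    | cond_pos hr h => rw [if_pos hr]; exact ⟨_, _, h, hQ⟩
    | cond_neg hr h => rw [if_neg hr]; exact ⟨_, _, h, hQ⟩
  · split
    · rintro ⟨_, _, h, hQ⟩
      exact ⟨_, _, .cond_pos ‹_› h, hQ⟩
    · rintro ⟨_, _, h, hQ⟩
      exact ⟨_, _, .cond_neg ‹_› h, hQ⟩

theorem wp_loop_pos {r : ℕ} {A : Cmd} (hr : 0 < s.reg r)
    (h : WP S A (fun τ s' => WP S (.loop r A) (fun τ' s'' => Q (τ + τ' + 1) s'') s') s) :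
    WP S (.loop r A) Q s := by
  obtain ⟨_, _, hA, _, _, hB, hQ⟩ := h
  exact ⟨_, _, .loop_pos hr hA hB, hQ⟩

theorem wp_loop_neg {r : ℕ} {A : Cmd} (hr : ¬ 0 < s.reg r) (h : Q 1 s) : WP S (.loop r A) Q s :=
  ⟨_, _, .loop_neg hr, h⟩

end

namespace MState

variable (s : MState) (r q : ℕ) (a z : ℤ)

theorem setReg_reg : (s.setReg r z).reg q = if q = r then z else s.reg q := by
  simp [setReg, Function.update_apply]

theorem setReg_mem : (s.setReg r z).mem = s.mem := rfl

theorem setReg_pos : (s.setReg r z).pos = s.pos := rfl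

theorem setMem_reg : (s.setMem a z).reg = s.reg := rfl

theorem setMem_pos : (s.setMem a z).pos = s.pos := rfl

theorem setMem_mem (b : ℤ) : (s.setMem a z).mem b = if b = a then z else s.mem b := by
  simp [setMem, Function.update_apply]

theorem nextExample_reg : s.nextExample.reg = s.reg := rfl

theorem nextExample_mem : s.nextExample.mem = s.mem := rfl

theorem nextExample_pos : s.nextExample.pos = s.pos + 1 := rfl

end MState

/-! ### The programs

Register `3` holds the constant `1`, register `2` the dimension, register `4` the exponent of the
kernel and register `5` the length of the used part of the memory, which starts at address `0` and
consists of blocks of `d + 1` cells: the coordinates of an example and its label. Registers from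
`10` on are scratch registers, and each subprogram leaves the registers below its own scratch range
unchanged, apart from those that its description names; register `9` is never written and serves as the constant `0` during the setup. -/

/-- Adds `reg 20` times register `17` to register `19`. -/
def mulLoop : Cmd := .loop 20 (.seq (.add 19 19 17) (.sub 20 20 3))

/-- Multiplies register `17` by register `src`. -/
def mulReg (src : ℕ) : Cmd :=
  .seq (.const 19 0) <| .seq (.add 20 src 19) <| .seq mulLoop <| .seq (.const 20 0) (.add 17 19 20)

/-- Multiplies register `17` by the power of register `src` with exponent in register `18`. -/
def powLoop (src : ℕ) : Cmd := .loop 18 (.seq (mulReg src) (.sub 18 18 3))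

/-- Adds to register `13` the number of common ones of the current instance and the block that
starts at the address in register `11`, restricted to the coordinates below register `14`. -/
def dotLoop : Cmd :=
  .loop 14 <| .seq (.sub 14 14 3) <| .seq (.coord 15 14) <| .seq (.add 16 11 14) <|
    .seq (.load 16 16) <| .seq (.add 15 15 16) <| .seq (.sub 15 15 3) <|
      .cond 15 (.add 13 13 3) .skip

/-- Adds to register `10` the contribution to the kernel sum of the block that starts at the address
in register `11`, and moves on to the next block. -/
def evalRow : Cmd :=
  .seq (.const 13 1) <| .seq (.const 14 0) <| .seq (.add 14 2 14) <| .seq dotLoop <|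
    .seq (.const 17 1) <| .seq (.const 18 0) <| .seq (.add 18 4 18) <| .seq (powLoop 13) <|
    .seq (.add 12 11 2) <| .seq (.load 12 12) <| .seq (.add 11 11 2) <| .seq (.add 11 11 3) <|
    .seq (.cond 12 (.add 10 10 17) (.sub 10 10 17)) (.sub 12 5 11)

/-- Computes in register `10` the kernel sum of the stored examples at the current instance. -/
def evalProg : Cmd :=
  .seq (.const 10 0) <| .seq (.const 11 0) <| .seq (.sub 12 5 11) (.loop 12 evalRow)

/-- Stores the coordinates below register `14` of the current instance in a new block. -/
def storeLoop : Cmd :=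
  .loop 14 <| .seq (.sub 14 14 3) <| .seq (.coord 15 14) <| .seq (.add 16 5 14) (.store 16 15)

/-- Stores the current example in a new block and updates register `5`. -/
def storeProg : Cmd :=
  .seq (.const 14 0) <| .seq (.add 14 2 14) <| .seq storeLoop <| .seq (.label 15) <|
    .seq (.add 16 5 2) <| .seq (.store 16 15) (.add 5 16 3)

/-- Processes one example. Register `6` counts the examples that the current classifier still has to
classify correctly in a row, starting from register `7`; a mistake updates the classifier and
resets the counter. Once the counter is `0` the classifier is not changed any more. -/
def exampleProg : Cmd :=
  .seq (.cond 6
    (.seq evalProg <| .seq (.label 12) <| .cond 12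
      (.cond 10 (.sub 6 6 3) (.seq storeProg <| .seq (.const 15 0) (.add 6 7 15)))
      (.cond 10 (.seq storeProg <| .seq (.const 15 0) (.add 6 7 15)) (.sub 6 6 3)))
    .skip) <|
  .seq .advance (.sub 8 8 3)

/-- Processes as many examples as register `8` says. -/
def mainLoop : Cmd := .loop 8 exampleProg

/-- Computes the number `k * Y` of examples to be processed (register `8`) and the number `k` of
correct answers in a row that are asked for (registers `6` and `7`). Here `Y = (d + 1) ^ q` for the
content `q` of register `18`, and `k = 2 * D * a ^ 2 * Y` for the content `a = ⌈1/ε⌉` of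
register `1`. -/
def countersProg (D : ℕ) : Cmd :=
  .seq (powLoop 11) <| .seq (.add 12 17 9) <|
    .seq (mulReg 1) <| .seq (mulReg 1) <| .seq (.const 13 (2 * D : ℕ)) <| .seq (mulReg 13) <|
    .seq (.add 7 17 9) <| .seq (.add 6 7 9) <| .seq (mulReg 12) (.add 8 17 9)

/-- Computes all parameters. The exponents `r` of the kernel and `q` of the bound `(d + 1) ^ q` on
the number of mistakes are `r₁`, `q₁` in dimension one and `r₂`, `q₂` in higher dimensions. -/
def setupProg (r₁ q₁ r₂ q₂ D : ℕ) : Cmd :=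
  .seq (.const 3 1) <| .seq (.add 2 0 9) <| .seq (.sub 10 2 3) <|
    .seq (.cond 10 (.seq (.const 4 r₂) (.const 18 q₂)) (.seq (.const 4 r₁) (.const 18 q₁))) <|
    .seq (.add 11 2 3) <| .seq (.const 17 1) (countersProg D)

/-- The learner. -/
def learnProg (r₁ q₁ r₂ q₂ D : ℕ) : Cmd := .seq (setupProg r₁ q₁ r₂ q₂ D) mainLoop

/-- The evaluation, in register `0`, of the classifier that the learner has left in the memory. -/
def queryProg : Cmd := .seq evalProg <| .seq (.const 11 0) (.add 0 10 11)

/-! ### Correctness and running time of the programs -/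

section

variable {d : ℕ} {S : ℕ → Cube d × SignType}

theorem wp_mulLoop (n : ℕ) (s : MState) (h3 : s.reg 3 = 1) (hn : s.reg 20 = n) :
    WP S mulLoop (fun τ s' => τ = 3 * n + 1 ∧ s'.mem = s.mem ∧ s'.pos = s.pos ∧
      s'.reg 19 = s.reg 19 + s.reg 17 * n ∧ ∀ q < 19, s'.reg q = s.reg q) s := by
  induction n generalizing s with
  | zero => exact wp_loop_neg (by simp [hn]) (by simp)
  | succ n ih =>
    refine wp_loop_pos (by rw [hn]; positivity) ?_
    simp only [wp_seq, wp_add, wp_sub]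
    refine (ih _ ?_ ?_).mono ?_
    · simp [MState.setReg_reg, h3]
    · simp [MState.setReg_reg, h3, hn]
    · rintro τ s' ⟨h1, h2, h3, h4, h5⟩
      refine ⟨by omega, h2, h3, ?_, fun q hq => ?_⟩
      · rw [h4]; simp [MState.setReg_reg]; ring
      · rw [h5 q hq]
        simp [MState.setReg_reg, show q ≠ 19 by omega, show q ≠ 20 by omega]

theorem wp_mulReg {src : ℕ} (hsrc : src < 17) (n : ℕ) (s : MState) (h3 : s.reg 3 = 1)
    (hn : s.reg src = n) :
    WP S (mulReg src) (fun τ s' => τ = 3 * n + 5 ∧ s'.mem = s.mem ∧ s'.pos = s.pos ∧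
      s'.reg 17 = s.reg 17 * n ∧ ∀ q < 19, q ≠ 17 → s'.reg q = s.reg q) s := by
  unfold mulReg
  simp only [wp_seq, wp_const, wp_add]
  refine (wp_mulLoop n _ ?_ ?_).mono ?_
  · simp [MState.setReg_reg, h3]
  · simp [MState.setReg_reg, hn, show src ≠ 19 by omega]
  · rintro τ s' ⟨h1, h2, h3, h4, h5⟩
    refine ⟨by omega, h2, h3, ?_, fun q hq hq' => ?_⟩
    · simp [MState.setReg_reg, h4]
    · simp [MState.setReg_reg, h5 q hq, hq', show q ≠ 19 by omega, show q ≠ 20 by omega]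

theorem wp_powLoop {src : ℕ} (hsrc : src < 17) (n m : ℕ) (s : MState) (h3 : s.reg 3 = 1)
    (hn : s.reg src = n) (hm : s.reg 18 = m) :
    WP S (powLoop src) (fun τ s' => τ = m * (3 * n + 7) + 1 ∧ s'.mem = s.mem ∧ s'.pos = s.pos ∧
      s'.reg 17 = s.reg 17 * n ^ m ∧ ∀ q < 17, s'.reg q = s.reg q) s := by
  induction m generalizing s with
  | zero => exact wp_loop_neg (by simp [hm]) (by simp)
  | succ m ih =>
    refine wp_loop_pos (by rw [hm]; positivity) ?_
    simp only [wp_seq, wp_sub]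
    refine (wp_mulReg hsrc n _ h3 hn).mono ?_
    rintro τ s' ⟨h1, h2, h3', h4, h5⟩
    have e3 := (h5 3 (by norm_num) (by norm_num)).trans h3
    refine (ih _ ?_ ?_ ?_).mono ?_
    · simp [MState.setReg_reg, e3]
    · simp [MState.setReg_reg, show src ≠ 18 by omega, h5 src (by omega) (by omega), hn]
    · simp [MState.setReg_reg, h5 18 (by norm_num) (by norm_num), e3, hm]
    · rintro τ' s'' ⟨g1, g2, g3, g4, g5⟩
      refine ⟨by rw [g1, h1]; ring, g2.trans h2, g3.trans h3', ?_, fun q hq => ?_⟩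
      · rw [g4]; simp [MState.setReg_reg, h4]; ring
      · rw [g5 q hq]
        simp [MState.setReg_reg, h5 q (by omega) (by omega), show q ≠ 18 by omega]

theorem Cube.get_mem (x : Cube d) (j : ℤ) : x.get j = 0 ∨ x.get j = 1 := by
  unfold Cube.get
  split
  · split <;> simp
  · simp

theorem wp_dotLoop (z : Cube d) (n : ℕ) (s : MState) (h3 : s.reg 3 = 1) (hn : s.reg 14 = n)
    (hz : ∀ j < n, s.mem (s.reg 11 + (j : ℕ)) = z.get (j : ℕ)) :
    WP S dotLoop (fun τ s' => τ = 9 * n + 1 ∧ s'.mem = s.mem ∧ s'.pos = s.pos ∧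
      s'.reg 13 = s.reg 13 + ∑ j ∈ Finset.range n, z.get j * (S s.pos).1.get j ∧
      ∀ q < 13, s'.reg q = s.reg q) s := by
  induction n generalizing s with
  | zero => exact wp_loop_neg (by simp [hn]) (by simp)
  | succ n ih =>
    refine wp_loop_pos (by rw [hn]; positivity) ?_
    have hzn := hz n (by omega)
    have hd14 : (n : ℤ) + 1 - 1 = n := by ring
    simp only [wp_seq, wp_sub, wp_coord, wp_add, wp_load, wp_cond, wp_skip]
    simp only [MState.setReg_reg, MState.setReg_mem, MState.setReg_pos, h3, hn, Nat.cast_add,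
      Nat.cast_one, hd14, hzn, if_true, reduceIte, Nat.reduceEqDiff]
    split
    · rename_i hpos
      have hprod : z.get n * (S s.pos).1.get n = 1 := by
        rcases z.get_mem n with h | h <;> rcases (S s.pos).1.get_mem n with h' | h' <;>
          rw [h, h'] at hpos ⊢ <;> simp at hpos ⊢
      refine (ih _ ?_ ?_ ?_).mono ?_
      · simp [MState.setReg_reg, h3]
      · simp [MState.setReg_reg]
      · intro j hj
        simpa [MState.setReg_reg, MState.setReg_mem] using hz j (by omega)
      · rintro τ s' ⟨h1, h2, h3, h4, h5⟩
        refine ⟨by omega, h2, h3, ?_, fun q hq => ?_⟩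
        · rw [h4, Finset.sum_range_succ, hprod]; simp [MState.setReg_reg, MState.setReg_pos]; ring
        · rw [h5 q hq]
          simp [MState.setReg_reg, show q ≠ 13 by omega, show q ≠ 14 by omega,
            show q ≠ 15 by omega, show q ≠ 16 by omega]
    · rename_i hpos
      have hprod : z.get n * (S s.pos).1.get n = 0 := by
        rcases z.get_mem n with h | h <;> rcases (S s.pos).1.get_mem n with h' | h' <;>
          rw [h, h'] at hpos ⊢ <;> simp at hpos ⊢
      refine (ih _ ?_ ?_ ?_).mono ?_
      · simp [MState.setReg_reg, h3]
      · simp [MState.setReg_reg]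
      · intro j hj
        simpa [MState.setReg_reg, MState.setReg_mem] using hz j (by omega)
      · rintro τ s' ⟨h1, h2, h3, h4, h5⟩
        refine ⟨by omega, h2, h3, ?_, fun q hq => ?_⟩
        · rw [h4, Finset.sum_range_succ, hprod]; simp [MState.setReg_reg, MState.setReg_pos]
        · rw [h5 q hq]
          simp [MState.setReg_reg, show q ≠ 14 by omega, show q ≠ 15 by omega,
            show q ≠ 16 by omega]

/-- From the address `p` on, the memory holds the examples of the list, one block of `d + 1` cells
for each of them. -/
def Encodes (mem : ℤ → ℤ) : ℤ → List (Cube d × SignType) → Prop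
  | _, [] => True
  | p, e :: l => (∀ j < d, mem (p + (j : ℕ)) = e.1.get (j : ℕ)) ∧ mem (p + d) = (e.2 : ℤ) ∧
      Encodes mem (p + d + 1) l

theorem Encodes.congr {mem mem' : ℤ → ℤ} {l : List (Cube d × SignType)} {p : ℤ}
    (h : Encodes mem p l) (hm : ∀ a < p + (d + 1) * l.length, mem' a = mem a) :
    Encodes mem' p l := by
  induction l generalizing p with
  | nil => trivial
  | cons e l ih =>
    obtain ⟨h1, h2, h3⟩ := h
    rw [List.length_cons] at hm
    push_cast at hm
    have hpos : (0 : ℤ) ≤ (d + 1) * l.length := by positivity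
    refine ⟨fun j hj => ?_, ?_, ih h3 fun a ha => hm a (by linarith)⟩
    · rw [hm _ (by have : (j : ℤ) < d := by exact_mod_cast hj
                   linarith), h1 j hj]
    · rw [hm _ (by linarith), h2]

theorem Encodes.append {mem : ℤ → ℤ} {l l' : List (Cube d × SignType)} {p : ℤ}
    (h : Encodes mem p l) (h' : Encodes mem (p + (d + 1) * l.length) l') :
    Encodes mem p (l ++ l') := by
  induction l generalizing p with
  | nil => simpa using h'
  | cons e l ih =>
    obtain ⟨h1, h2, h3⟩ := h
    refine ⟨h1, h2, ih h3 ?_⟩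
    convert h' using 1
    rw [List.length_cons]
    push_cast
    ring

theorem signType_cast_pos_iff (y : SignType) : 0 < (y : ℤ) ↔ 0 < y := by
  cases y <;> decide

/-- A bound on the number of steps spent on a stored example. -/
def rowCost (d r : ℕ) : ℕ := 9 * d + r * (3 * d + 10) + 17

theorem Cube.dot_nonneg (z x : Cube d) : 0 ≤ z.dot x :=
  Finset.sum_nonneg fun j _ => by
    rcases z.get_mem j with h | h <;> rcases x.get_mem j with h' | h' <;> simp [h, h']

theorem Cube.dot_le (z x : Cube d) : z.dot x ≤ d := by
  calc z.dot x ≤ ∑ j ∈ Finset.range d, 1 := Finset.sum_le_sum fun j _ => by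
        rcases z.get_mem j with h | h <;> rcases x.get_mem j with h' | h' <;> simp [h, h']
    _ = d := by simp

theorem wp_evalRow (r : ℕ) (e : Cube d × SignType) (s : MState) (h2 : s.reg 2 = d)
    (h3 : s.reg 3 = 1) (h4 : s.reg 4 = r)
    (hz : ∀ j < d, s.mem (s.reg 11 + (j : ℕ)) = e.1.get (j : ℕ))
    (hy : s.mem (s.reg 11 + d) = (e.2 : ℤ)) :
    WP S evalRow (fun τ s' => τ + 1 ≤ rowCost d r ∧ s'.mem = s.mem ∧ s'.pos = s.pos ∧
      s'.reg 10 = s.reg 10 + exampleSign e * (1 + e.1.dot (S s.pos).1) ^ r ∧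
      s'.reg 11 = s.reg 11 + d + 1 ∧ s'.reg 12 = s.reg 5 - (s.reg 11 + d + 1) ∧
      ∀ q < 10, s'.reg q = s.reg q) s := by
  unfold evalRow
  simp only [wp_seq, wp_const, wp_add]
  refine (wp_dotLoop e.1 d _ ?_ ?_ ?_).mono ?_
  · simp [MState.setReg_reg, h3]
  · simp [MState.setReg_reg, h2]
  · simpa [MState.setReg_reg, MState.setReg_mem] using hz
  rintro τ s₁ ⟨a1, a2, a3, a4, a5⟩
  have a13 : s₁.reg 13 = 1 + e.1.dot (S s.pos).1 := by
    rw [a4]; simp [MState.setReg_reg, MState.setReg_pos, Cube.dot]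
  have hreg : ∀ q < 13, s₁.reg q = s.reg q := fun q hq => by
    rw [a5 q hq]; simp [MState.setReg_reg, show q ≠ 13 by omega, show q ≠ 14 by omega]
  have hdot := e.1.dot_nonneg (S s.pos).1
  have hdot' := e.1.dot_le (S s.pos).1
  obtain ⟨n, hn⟩ := Int.eq_ofNat_of_zero_le hdot
  refine (wp_powLoop (src := 13) (by norm_num) (1 + n) r _ ?_ ?_ ?_).mono ?_
  · simp [MState.setReg_reg, hreg, h3]
  · simp [MState.setReg_reg, a13, hn]
  · simp [MState.setReg_reg, hreg, h4]
  rintro τ' s₂ ⟨b1, b2, b3, b4, b5⟩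
  have b17 : s₂.reg 17 = (1 + e.1.dot (S s.pos).1) ^ r := by
    rw [b4]; simp [MState.setReg_reg, hn]
  have hreg2 : ∀ q < 13, s₂.reg q = s.reg q := fun q hq => by
    rw [b5 q (by omega)]
    simp [MState.setReg_reg, hreg q hq, show q ≠ 17 by omega, show q ≠ 18 by omega]
  have hmem : s₂.mem = s.mem := by
    rw [b2]; simp only [MState.setReg_mem]; rw [a2]; rfl
  have hpos : s₂.pos = s.pos := by
    rw [b3]; simp only [MState.setReg_pos]; rw [a3]; rfl
  have hcost : r * (3 * (1 + n) + 7) ≤ r * (3 * d + 10) := by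
    have : n ≤ d := by exact_mod_cast hn ▸ hdot'
    exact Nat.mul_le_mul_left _ (by omega)
  simp only [wp_load, wp_cond, wp_add, wp_sub]
  simp only [MState.setReg_reg, MState.setReg_mem, hmem, if_true, reduceIte, Nat.reduceEqDiff,
    hreg2 11 (by norm_num), hreg2 2 (by norm_num), hreg2 3 (by norm_num), hreg2 5 (by norm_num),
    hreg2 10 (by norm_num), h2, h3, hy, signType_cast_pos_iff]
  by_cases hy0 : 0 < e.2
  all_goals
    simp only [hy0, if_true, if_false]
    refine ⟨?_, ?_, ?_, ?_, ?_, ?_, fun q hq => ?_⟩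
    · unfold rowCost; omega
    · simp
    · simp [MState.setReg_pos, hpos]
    · simp [b17, exampleSign, hy0]
      try ring
    · simp
    · simp
    · simp [show q ≠ 10 by omega, show q ≠ 11 by omega, show q ≠ 12 by omega,
        hreg2 q (by omega)]

theorem wp_evalLoop (r : ℕ) (l : List (Cube d × SignType)) (s : MState) (h2 : s.reg 2 = d)
    (h3 : s.reg 3 = 1) (h4 : s.reg 4 = r) (h5 : s.reg 5 = s.reg 11 + (d + 1) * l.length)
    (h12 : s.reg 12 = s.reg 5 - s.reg 11) (hl : Encodes s.mem (s.reg 11) l) :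
    WP S (.loop 12 evalRow) (fun τ s' => τ ≤ l.length * rowCost d r + 1 ∧ s'.mem = s.mem ∧
      s'.pos = s.pos ∧ s'.reg 10 = s.reg 10 + kernelSum r l (S s.pos).1 ∧
      ∀ q < 10, s'.reg q = s.reg q) s := by
  induction l generalizing s with
  | nil => exact wp_loop_neg (by rw [h12, h5]; simp) (by simp [kernelSum])
  | cons e l ih =>
    obtain ⟨e1, e2, e3⟩ := hl
    rw [List.length_cons] at h5
    push_cast at h5
    refine wp_loop_pos (by rw [h12, h5, add_sub_cancel_left]; positivity) ?_
    refine (wp_evalRow r e s h2 h3 h4 e1 e2).mono ?_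
    rintro τ s₁ ⟨a1, a2, a3, a4, a5, a6, a7⟩
    have a75 := a7 5 (by norm_num)
    refine (ih s₁ ?_ ?_ ?_ ?_ ?_ ?_).mono ?_
    · rw [a7 2 (by norm_num), h2]
    · rw [a7 3 (by norm_num), h3]
    · rw [a7 4 (by norm_num), h4]
    · rw [a75, a5, h5]; ring
    · rw [a6, a75, a5]
    · rw [a2, a5]; exact e3
    · rintro τ' s₂ ⟨b1, b2, b3, b4, b5⟩
      refine ⟨?_, b2.trans a2, b3.trans a3, ?_, fun q hq => (b5 q hq).trans (a7 q hq)⟩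
      · rw [List.length_cons, Nat.add_mul]; omega
      · rw [b4, a4, a3]; simp [kernelSum]; ring

theorem wp_evalProg (r : ℕ) (l : List (Cube d × SignType)) (s : MState) (h2 : s.reg 2 = d)
    (h3 : s.reg 3 = 1) (h4 : s.reg 4 = r) (h5 : s.reg 5 = (d + 1) * l.length)
    (hl : Encodes s.mem 0 l) :
    WP S evalProg (fun τ s' => τ ≤ l.length * rowCost d r + 4 ∧ s'.mem = s.mem ∧
      s'.pos = s.pos ∧ s'.reg 10 = kernelSum r l (S s.pos).1 ∧
      ∀ q < 10, s'.reg q = s.reg q) s := by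
  unfold evalProg
  simp only [wp_seq, wp_const, wp_sub]
  refine (wp_evalLoop r l _ ?_ ?_ ?_ ?_ ?_ ?_).mono ?_
  · simp [MState.setReg_reg, h2]
  · simp [MState.setReg_reg, h3]
  · simp [MState.setReg_reg, h4]
  · simp [MState.setReg_reg, h5]
  · simp [MState.setReg_reg]
  · simpa [MState.setReg_reg, MState.setReg_mem] using hl
  · rintro τ s' ⟨a1, a2, a3, a4, a5⟩
    refine ⟨by omega, a2, a3, ?_, fun q hq => ?_⟩
    · rw [a4]; simp [MState.setReg_reg, MState.setReg_pos]
    · rw [a5 q hq]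
      simp [MState.setReg_reg, show q ≠ 10 by omega, show q ≠ 11 by omega, show q ≠ 12 by omega]

theorem wp_storeLoop (n : ℕ) (s : MState) (h3 : s.reg 3 = 1) (hn : s.reg 14 = n) :
    WP S storeLoop (fun τ s' => τ = 5 * n + 1 ∧ s'.pos = s.pos ∧
      (∀ j < n, s'.mem (s.reg 5 + (j : ℕ)) = (S s.pos).1.get (j : ℕ)) ∧
      (∀ a, (a < s.reg 5 ∨ s.reg 5 + n ≤ a) → s'.mem a = s.mem a) ∧
      ∀ q < 14, s'.reg q = s.reg q) s := by
  induction n generalizing s with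
  | zero => exact wp_loop_neg (by simp [hn]) (by simp)
  | succ n ih =>
    refine wp_loop_pos (by rw [hn]; positivity) ?_
    have hd14 : (n : ℤ) + 1 - 1 = n := by ring
    simp only [wp_seq, wp_sub, wp_coord, wp_add, wp_store]
    refine (ih _ ?_ ?_).mono ?_
    · simp [MState.setReg_reg, MState.setMem_reg, h3]
    · simp [MState.setReg_reg, MState.setMem_reg, h3, hn]
    · rintro τ s' ⟨h1, h2, h4, h5, h6⟩
      simp [MState.setReg_reg, MState.setMem_reg, MState.setMem_mem, MState.setReg_mem,
        MState.setReg_pos, MState.setMem_pos, h3, hn] at h2 h4 h5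
      refine ⟨by omega, h2, fun j hj => ?_, fun a ha => ?_, fun q hq => ?_⟩
      · rcases Nat.lt_succ_iff_lt_or_eq.mp hj with hj | rfl
        · exact h4 j hj
        · rw [h5 _ (Or.inr le_rfl), if_pos rfl]
      · push_cast at ha
        rw [h5 a (by omega), if_neg (by omega)]
      · rw [h6 q hq]
        simp [MState.setReg_reg, MState.setMem_reg, show q ≠ 14 by omega, show q ≠ 15 by omega,
          show q ≠ 16 by omega]

theorem wp_storeProg (l : List (Cube d × SignType)) (s : MState) (h2 : s.reg 2 = d)
    (h3 : s.reg 3 = 1) (h5 : s.reg 5 = (d + 1) * l.length) (hl : Encodes s.mem 0 l) :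
    WP S storeProg (fun τ s' => τ = 5 * d + 7 ∧ s'.pos = s.pos ∧
      Encodes s'.mem 0 (l ++ [S s.pos]) ∧ s'.reg 5 = (d + 1) * (l ++ [S s.pos]).length ∧
      ∀ q < 14, q ≠ 5 → s'.reg q = s.reg q) s := by
  unfold storeProg
  simp only [wp_seq, wp_const, wp_add, wp_label, wp_store]
  refine (wp_storeLoop d _ ?_ ?_).mono ?_
  · simp [MState.setReg_reg, h3]
  · simp [MState.setReg_reg, h2]
  · rintro τ s' ⟨a1, a2, a3, a4, a5⟩
    simp only [MState.setReg_reg, MState.setReg_mem, MState.setReg_pos, reduceIte,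
      Nat.reduceEqDiff] at a2 a3 a4
    have hreg : ∀ q < 14, s'.reg q = s.reg q := fun q hq => by
      rw [a5 q hq]; simp [MState.setReg_reg, show q ≠ 14 by omega]
    refine ⟨by omega, a2, Encodes.append (hl.congr fun a ha => ?_) ⟨fun j hj => ?_, ?_, trivial⟩,
      ?_, fun q hq hq5 => ?_⟩
    · rw [zero_add, ← h5] at ha
      simp only [MState.setReg_reg, MState.setReg_mem, MState.setMem_mem, MState.setMem_reg,
        reduceIte, Nat.reduceEqDiff, hreg 5 (by norm_num), hreg 2 (by norm_num), h2]
      rw [if_neg (by omega), a4 a (Or.inl ha)]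
    · rw [zero_add, ← h5]
      simp only [MState.setReg_reg, MState.setReg_mem, MState.setMem_mem, MState.setMem_reg,
        reduceIte, Nat.reduceEqDiff, hreg 5 (by norm_num), hreg 2 (by norm_num), h2]
      rw [if_neg (by omega), a3 j hj]
    · rw [zero_add, ← h5]
      simp only [MState.setReg_reg, MState.setReg_mem, MState.setMem_mem, MState.setMem_reg,
        reduceIte, Nat.reduceEqDiff, hreg 5 (by norm_num), hreg 2 (by norm_num), h2, a2]
    · simp [MState.setReg_reg, MState.setMem_reg, hreg, h2, h3, h5]
      ring
    · simp [MState.setReg_reg, MState.setMem_reg, hreg q hq, hq5, show q ≠ 15 by omega,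
        show q ≠ 16 by omega]

end

section

variable {d : ℕ} {S : ℕ → Cube d × SignType}

/-- What the learner does with an example: the first component lists the mistakes so far, the
second one counts the correct answers that are still missing. -/
def perceptronStep (r k : ℕ) (p : List (Cube d × SignType) × ℕ) (e : Cube d × SignType) :
    List (Cube d × SignType) × ℕ :=
  if p.2 = 0 then p
  else if (0 < kernelSum r p.1 e.1 ↔ 0 < e.2) then (p.1, p.2 - 1) else (p.1 ++ [e], k)

/-- The mistakes and the counter of the learner after `t` examples. -/
def perceptronRun (r k : ℕ) (S : ℕ → Cube d × SignType) : ℕ → List (Cube d × SignType) × ℕ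
  | 0 => ([], k)
  | t + 1 => perceptronStep r k (perceptronRun r k S t) (S t)

theorem length_perceptronStep_le (r k : ℕ) (p : List (Cube d × SignType) × ℕ)
    (e : Cube d × SignType) : (perceptronStep r k p e).1.length ≤ p.1.length + 1 := by
  unfold perceptronStep
  split
  · simp
  · split <;> simp

theorem length_perceptronRun_le (r k t : ℕ) : (perceptronRun r k S t).1.length ≤ t := by
  induction t with
  | zero => simp [perceptronRun]
  | succ t ih => exact (length_perceptronStep_le _ _ _ _).trans (by omega)

/-- The machine state `s` represents the state `p` of the learner after `t` examples. -/
structure Represents (d r k : ℕ) (s : MState) (p : List (Cube d × SignType) × ℕ) (t : ℕ) :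
    Prop where
  reg2 : s.reg 2 = d
  reg3 : s.reg 3 = 1
  reg4 : s.reg 4 = r
  reg5 : s.reg 5 = (d + 1) * p.1.length
  reg6 : s.reg 6 = p.2
  reg7 : s.reg 7 = k
  pos : s.pos = t
  enc : Encodes s.mem 0 p.1

/-- A bound on the number of steps for an example if `m` examples are stored. -/
def exampleCost (d r m : ℕ) : ℕ := m * rowCost d r + 5 * d + 20

theorem wp_exampleProg {r k t : ℕ} {p : List (Cube d × SignType) × ℕ} {s : MState}
    (h : Represents d r k s p t) :
    WP S exampleProg (fun τ s' => τ + 1 ≤ exampleCost d r p.1.length ∧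
      Represents d r k s' (perceptronStep r k p (S t)) (t + 1) ∧ s'.reg 8 = s.reg 8 - 1) s := by
  obtain ⟨h2, h3, h4, h5, h6, h7, hpos, henc⟩ := h
  obtain ⟨l, c⟩ := p
  simp only at h5 h6 henc
  unfold exampleProg exampleCost
  simp only [wp_seq, wp_cond, wp_skip, wp_advance, wp_sub]
  by_cases hc : c = 0
  · subst hc
    rw [if_neg (by rw [h6]; simp)]
    refine ⟨by omega, ⟨?_, ?_, ?_, ?_, ?_, ?_, ?_, ?_⟩, ?_⟩ <;>
      simp [MState.setReg_reg, MState.nextExample_reg, MState.setReg_pos, MState.nextExample_pos,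
        MState.setReg_mem, MState.nextExample_mem, perceptronStep, *]
  · have hc0 : 0 < s.reg 6 := by rw [h6]; exact_mod_cast Nat.pos_of_ne_zero hc
    rw [if_pos hc0]
    refine (wp_evalProg r l s h2 h3 h4 h5 henc).mono ?_
    rintro τ s₁ ⟨a1, a2, a3, a4, a5⟩
    -- the two branches: a correct answer and a mistake
    have hgood : (0 < kernelSum r l (S t).1 ↔ 0 < (S t).2) → ∀ τ₁ ≤ 10,
        (τ + τ₁ + 1 ≤ l.length * rowCost d r + 5 * d + 20 ∧
        Represents d r k (((((s₁.setReg 12 ((S t).2 : ℤ)).setReg 6 (s.reg 6 - 1)).nextExample).setReg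
          8 (s.reg 8 - 1))) (perceptronStep r k (l, c) (S t)) (t + 1)) := by
      intro hok τ₁ hτ₁
      have hstep : perceptronStep r k (l, c) (S t) = (l, c - 1) := by
        simp only [perceptronStep, if_neg hc, if_pos hok]
      rw [hstep]
      refine ⟨by omega, ?_, ?_, ?_, ?_, ?_, ?_, ?_, ?_⟩ <;>
        simp [MState.setReg_reg, MState.nextExample_reg, MState.setReg_pos,
          MState.nextExample_pos, MState.setReg_mem, MState.nextExample_mem, *]
      omega
    have hbad : ¬ (0 < kernelSum r l (S t).1 ↔ 0 < (S t).2) →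
        WP S storeProg (fun τ' s' => τ + τ' + 10 ≤ l.length * rowCost d r + 5 * d + 20 + 1 ∧
          s'.reg 3 = 1 ∧ s'.reg 8 = s.reg 8 ∧
          Represents d r k ((((s'.setReg 15 0).setReg 6 (s'.reg 7)).nextExample).setReg
            8 (s.reg 8 - 1)) (perceptronStep r k (l, c) (S t)) (t + 1))
          (s₁.setReg 12 ((S t).2 : ℤ)) := by
      intro hno
      have hstep : perceptronStep r k (l, c) (S t) = (l ++ [S t], k) := by
        simp only [perceptronStep, if_neg hc, if_neg hno]
      refine (wp_storeProg l _ ?_ ?_ ?_ ?_).mono ?_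
      · simp [MState.setReg_reg, a5, h2]
      · simp [MState.setReg_reg, a5, h3]
      · simp [MState.setReg_reg, a5, h5]
      · rw [MState.setReg_mem, a2]; exact henc
      · rintro τ' s₂ ⟨b1, b2, b3, b4, b5⟩
        rw [MState.setReg_pos, a3, hpos] at b2 b3 b4
        have hreg : ∀ q < 10, q ≠ 5 → s₂.reg q = s.reg q := fun q hq hq5 => by
          rw [b5 q (by omega) hq5, MState.setReg_reg, if_neg (by omega), a5 q hq]
        refine ⟨by omega, by simp [hreg, h3], by simp [hreg], ?_⟩
        rw [hstep]
        refine ⟨?_, ?_, ?_, ?_, ?_, ?_, ?_, ?_⟩ <;>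
          simp [MState.setReg_reg, MState.nextExample_reg, MState.setReg_pos,
            MState.nextExample_pos, MState.setReg_mem, MState.nextExample_mem, *]
    rw [hpos] at a3 a4
    have a53 := (a5 3 (by norm_num)).trans h3
    have a56 := a5 6 (by norm_num)
    have a58 := a5 8 (by norm_num)
    simp only [wp_label, wp_const, wp_add]
    simp only [MState.setReg_reg, a3, a4, reduceIte, Nat.reduceEqDiff, signType_cast_pos_iff,
      MState.nextExample_reg, a53, a56, a58]
    by_cases hy : 0 < (S t).2 <;> by_cases hk : 0 < kernelSum r l (S t).1 <;>
      simp only [hy, hk, if_true, if_false]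
    · obtain ⟨g1, g2⟩ := hgood (by simp [hy, hk]) 7 (by norm_num)
      exact ⟨by omega, g2, trivial⟩
    · refine (hbad (by simp [hy, hk])).mono ?_
      rintro τ' s' ⟨g1, g2, g3, g4⟩
      rw [g2, g3, add_zero]
      exact ⟨by omega, g4, rfl⟩
    · refine (hbad (by simp [hy, hk])).mono ?_
      rintro τ' s' ⟨g1, g2, g3, g4⟩
      rw [g2, g3, add_zero]
      exact ⟨by omega, g4, rfl⟩
    · obtain ⟨g1, g2⟩ := hgood (by simp [hy, hk]) 7 (by norm_num)
      exact ⟨by omega, g2, trivial⟩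

theorem wp_mainLoop {r k : ℕ} (n t : ℕ) {s : MState}
    (h : Represents d r k s (perceptronRun r k S t) t) (h8 : s.reg 8 = n) :
    WP S mainLoop (fun τ s' => τ ≤ n * exampleCost d r (t + n) + 1 ∧
      Represents d r k s' (perceptronRun r k S (t + n)) (t + n)) s := by
  induction n generalizing s t with
  | zero => exact wp_loop_neg (by simp [h8]) (by simpa using h)
  | succ n ih =>
    refine wp_loop_pos (by rw [h8]; positivity) ?_
    refine (wp_exampleProg h).mono ?_
    rintro τ s₁ ⟨a1, a2, a3⟩
    refine (ih (t + 1) a2 (by rw [a3, h8]; push_cast; ring)).mono ?_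
    rintro τ' s₂ ⟨b1, b2⟩
    rw [show t + 1 + n = t + (n + 1) by omega] at b1 b2
    refine ⟨?_, b2⟩
    have hlen := length_perceptronRun_le (S := S) r k t
    have : exampleCost d r (perceptronRun r k S t).1.length ≤ exampleCost d r (t + (n + 1)) := by
      unfold exampleCost
      gcongr
      omega
    rw [Nat.add_mul n 1]
    omega

/-- The number of correct answers in a row that the learner asks for. -/
def patience (D a Y : ℕ) : ℕ := Y * a * a * (2 * D)

/-- A bound on the running time of the learner, with `Y = (d + 1) ^ q`. -/
def learnCost (D d r q a : ℕ) : ℕ :=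
  q * (3 * d + 10) + 6 * a + 6 * D + 3 * (d + 1) ^ q + 40 +
    patience D a ((d + 1) ^ q) * (d + 1) ^ q *
      exampleCost d r (patience D a ((d + 1) ^ q) * (d + 1) ^ q)

theorem wp_countersProg {D a r q : ℕ} {s₀ : MState} (c1 : s₀.reg 1 = a) (c2 : s₀.reg 2 = d)
    (c3 : s₀.reg 3 = 1) (c4 : s₀.reg 4 = r) (c5 : s₀.reg 5 = 0) (c9 : s₀.reg 9 = 0)
    (c18 : s₀.reg 18 = q) (cpos : s₀.pos = 0) (c11 : s₀.reg 11 = d + 1) (c17 : s₀.reg 17 = 1) :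
    WP S (countersProg D) (fun τ s' =>
      τ ≤ q * (3 * d + 10) + 6 * a + 6 * D + 3 * (d + 1) ^ q + 29 ∧
      Represents d r (patience D a ((d + 1) ^ q)) s' ([], patience D a ((d + 1) ^ q)) 0 ∧
      s'.reg 8 = (patience D a ((d + 1) ^ q) * (d + 1) ^ q : ℕ)) s₀ := by
  set Y := (d + 1) ^ q with hY
  set k := patience D a Y with hk
  have hkY : (Y : ℤ) * a * a * (2 * D) = k := by rw [hk, patience]; push_cast; rfl
  unfold countersProg
  simp only [wp_seq, wp_add, wp_const]
  refine (wp_powLoop (src := 11) (by norm_num) (d + 1) q s₀ c3 (by simp [c11]) c18).mono ?_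
  rintro τ₁ s₁ ⟨a1, a2, a3, a4, a5⟩
  have a17 : s₁.reg 17 = Y := by rw [a4, c17, hY]; push_cast; ring
  refine (wp_mulReg (src := 1) (by norm_num) a _ ?_ ?_).mono ?_
  · simp [MState.setReg_reg, a5, c3]
  · simp [MState.setReg_reg, a5, c1]
  rintro τ₂ s₂ ⟨b1, b2, b3, b4, b5⟩
  have b17 : s₂.reg 17 = Y * a := by rw [b4]; simp [MState.setReg_reg, a17]
  have breg : ∀ i < 17, i ≠ 12 → s₂.reg i = s₀.reg i := fun i hi hi' => by
    rw [b5 i (by omega) (by omega), MState.setReg_reg, if_neg hi', a5 i hi]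
  have b12 : s₂.reg 12 = Y := by
    rw [b5 12 (by norm_num) (by norm_num)]
    simp [MState.setReg_reg, a17, a5, c9]
  refine (wp_mulReg (src := 1) (by norm_num) a _ (by simp [breg, c3]) (by simp [breg, c1])).mono ?_
  rintro τ₃ s₃ ⟨e1, e2, e3, e4, e5⟩
  refine (wp_mulReg (src := 13) (by norm_num) (2 * D) _ ?_ ?_).mono ?_
  · simp [MState.setReg_reg, e5, breg, c3]
  · simp [MState.setReg_reg]
  rintro τ₄ s₄ ⟨f1, f2, f3, f4, f5⟩
  have f17 : s₄.reg 17 = k := by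
    rw [f4, MState.setReg_reg, if_neg (by norm_num), e4, b17, ← hkY]
    push_cast
    ring
  have freg : ∀ i < 17, i ≠ 12 → i ≠ 13 → s₄.reg i = s₀.reg i := fun i hi hi' hi'' => by
    rw [f5 i (by omega) (by omega), MState.setReg_reg, if_neg hi'', e5 i (by omega) (by omega),
      breg i hi hi']
  have f12 : s₄.reg 12 = Y := by
    rw [f5 12 (by norm_num) (by norm_num), MState.setReg_reg, if_neg (by norm_num),
      e5 12 (by norm_num) (by norm_num), b12]
  refine (wp_mulReg (src := 12) (by norm_num) Y _ ?_ ?_).mono ?_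
  · simp [MState.setReg_reg, freg, c3]
  · simp [MState.setReg_reg, f12]
  rintro τ₅ s₅ ⟨g1, g2, g3, g4, g5⟩
  have g17 : s₅.reg 17 = k * Y := by rw [g4]; simp [MState.setReg_reg, f17]
  refine ⟨?_, ⟨?_, ?_, ?_, ?_, ?_, ?_, ?_, trivial⟩, ?_⟩
  · have : q * (3 * (d + 1) + 7) = q * (3 * d + 10) := by ring
    omega
  · simp [MState.setReg_reg, g5, freg, c2]
  · simp [MState.setReg_reg, g5, freg, c3]
  · simp [MState.setReg_reg, g5, freg, c4]
  · simp [MState.setReg_reg, g5, freg, c5]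
  · simp [MState.setReg_reg, g5, freg, c9, f17]
  · simp [MState.setReg_reg, g5, freg, c9, f17]
  · simp [MState.setReg_pos, g3, f3, e3, b3, a3, cpos]
  · simp [MState.setReg_reg, g5, freg, c9, g17]

theorem wp_learnProg (r₁ q₁ r₂ q₂ D a r q : ℕ)
    (hparam : (d = 1 ∧ r = r₁ ∧ q = q₁) ∨ (2 ≤ d ∧ r = r₂ ∧ q = q₂))
    {s : MState} (h0 : s.reg 0 = d) (h1 : s.reg 1 = a) (h2 : ∀ i ≥ 2, s.reg i = 0)
    (hpos : s.pos = 0) :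
    WP S (learnProg r₁ q₁ r₂ q₂ D) (fun τ s' => τ ≤ learnCost D d r q a ∧
      Represents d r (patience D a ((d + 1) ^ q)) s'
        (perceptronRun r (patience D a ((d + 1) ^ q)) S
          (patience D a ((d + 1) ^ q) * (d + 1) ^ q))
        (patience D a ((d + 1) ^ q) * (d + 1) ^ q)) s := by
  set Y := (d + 1) ^ q with hY
  set k := patience D a Y with hk
  have h9 := h2 9 (by norm_num)
  unfold learnProg setupProg
  simp only [wp_seq, wp_const, wp_add, wp_sub, wp_cond]
  simp only [MState.setReg_reg, reduceIte, Nat.reduceEqDiff, h0, h9, add_zero]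
  have final : ∀ τ₀ ≤ 9, ∀ τ s', τ ≤ q * (3 * d + 10) + 6 * a + 6 * D + 3 * Y + 29 →
      Represents d r k s' ([], k) 0 → s'.reg 8 = (k * Y : ℕ) →
      WP S mainLoop (fun τ' s'' => τ₀ + τ + τ' ≤ learnCost D d r q a ∧
        Represents d r k s'' (perceptronRun r k S (k * Y)) (k * Y)) s' := by
    intro τ₀ hτ₀ τ s' hτ hrep h8
    refine (wp_mainLoop (S := S) (k * Y) 0 hrep h8).mono ?_
    rintro τ' s'' ⟨a1, a2⟩
    rw [zero_add] at a1 a2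
    refine ⟨?_, a2⟩
    unfold learnCost
    rw [← hY, ← hk]
    omega
  rcases hparam with ⟨rfl, rfl, rfl⟩ | ⟨hd, rfl, rfl⟩
  · rw [if_neg (by norm_num)]
    refine (wp_countersProg (D := D) (a := a) (r := r) (q := q)
      ?_ ?_ ?_ ?_ ?_ ?_ ?_ ?_ ?_ ?_).mono ?_
    all_goals try simp [MState.setReg_reg, MState.setReg_pos, h1, h2, hpos]
    rintro τ s' hτ hrep h8
    refine (final 9 le_rfl τ s' hτ hrep h8).mono fun τ' s'' h => ⟨?_, h.2⟩
    have := h.1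
    omega
  · rw [if_pos (by have : (2 : ℤ) ≤ d := by exact_mod_cast hd
                   linarith)]
    refine (wp_countersProg (D := D) (a := a) (r := r) (q := q)
      ?_ ?_ ?_ ?_ ?_ ?_ ?_ ?_ ?_ ?_).mono ?_
    all_goals try simp [MState.setReg_reg, MState.setReg_pos, h1, h2, hpos]
    rintro τ s' hτ hrep h8
    refine (final 9 le_rfl τ s' hτ hrep h8).mono fun τ' s'' h => ⟨?_, h.2⟩
    have := h.1
    omega

theorem wp_queryProg {r k t : ℕ} {p : List (Cube d × SignType) × ℕ} {s : MState}
    (h : Represents d r k s p t) (x : Cube d) :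
    WP (fun _ => (x, 0)) queryProg (fun τ s' => τ ≤ p.1.length * rowCost d r + 6 ∧
      s'.reg 0 = kernelSum r p.1 x) s := by
  obtain ⟨h2, h3, h4, h5, h6, h7, hpos, henc⟩ := h
  unfold queryProg
  simp only [wp_seq, wp_const, wp_add]
  refine (wp_evalProg r p.1 s h2 h3 h4 h5 henc).mono ?_
  rintro τ s₁ ⟨a1, a2, a3, a4, a5⟩
  exact ⟨by omega, by simp [MState.setReg_reg, a4]⟩

end

/-! ### Mistakes and convergence of the learner -/

section

variable {d r k : ℕ} {S : ℕ → Cube d × SignType}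

/-- The kernel perceptron that has made the mistakes `l` errs on the example `e`. -/
def Errs (r : ℕ) (l : List (Cube d × SignType)) (e : Cube d × SignType) : Prop :=
  ¬ (0 < kernelSum r l e.1 ↔ 0 < e.2)

theorem perceptronRun_succ_eq (t : ℕ) :
    ((perceptronRun r k S t).2 = 0 ∧ perceptronRun r k S (t + 1) = perceptronRun r k S t) ∨
    ((perceptronRun r k S t).2 ≠ 0 ∧ ¬ Errs r (perceptronRun r k S t).1 (S t) ∧
      perceptronRun r k S (t + 1)
        = ((perceptronRun r k S t).1, (perceptronRun r k S t).2 - 1)) ∨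
    ((perceptronRun r k S t).2 ≠ 0 ∧ Errs r (perceptronRun r k S t).1 (S t) ∧
      perceptronRun r k S (t + 1) = ((perceptronRun r k S t).1 ++ [S t], k)) := by
  rw [perceptronRun, perceptronStep, Errs]
  split_ifs with h1 h2
  · exact Or.inl ⟨h1, rfl⟩
  · exact Or.inr (Or.inl ⟨h1, not_not.mpr h2, rfl⟩)
  · exact Or.inr (Or.inr ⟨h1, h2, rfl⟩)

theorem perceptronRun_congr {S' : ℕ → Cube d × SignType} {t : ℕ} (h : ∀ i < t, S i = S' i) :
    perceptronRun r k S t = perceptronRun r k S' t := by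
  induction t with
  | zero => rfl
  | succ t ih => rw [perceptronRun, perceptronRun, ih fun i hi => h i (by omega), h t (by omega)]

/-- The counter of the learner records a block of consecutive examples on which the current
classifier, which was already the current one before the block, is correct. -/
theorem perceptronRun_survivor (t : ℕ) : (perceptronRun r k S t).2 ≤ k ∧
    ∃ t₀, t₀ + (k - (perceptronRun r k S t).2) ≤ t ∧
      (perceptronRun r k S t₀).1 = (perceptronRun r k S t).1 ∧
      ∀ j < k - (perceptronRun r k S t).2, ¬ Errs r (perceptronRun r k S t).1 (S (t₀ + j)) := by
  -- as long as the learner is active, the block ends at the current example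
  suffices h : (perceptronRun r k S t).2 ≤ k ∧
      ∃ t₀, t₀ + (k - (perceptronRun r k S t).2) ≤ t ∧
        ((perceptronRun r k S t).2 ≠ 0 → t₀ + (k - (perceptronRun r k S t).2) = t) ∧
        (perceptronRun r k S t₀).1 = (perceptronRun r k S t).1 ∧
        ∀ j < k - (perceptronRun r k S t).2,
          ¬ Errs r (perceptronRun r k S t).1 (S (t₀ + j)) by
    obtain ⟨h1, t₀, h2, -, h3⟩ := h
    exact ⟨h1, t₀, h2, h3⟩
  induction t with
  | zero => exact ⟨le_rfl, 0, by simp [perceptronRun], by simp [perceptronRun], rfl,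
      by simp [perceptronRun]⟩
  | succ t ih =>
    obtain ⟨h1, t₀, h2, h3, h4, h5⟩ := ih
    rcases perceptronRun_succ_eq (r := r) (k := k) (S := S) t with
      ⟨c0, heq⟩ | ⟨c0, hok, heq⟩ | ⟨c0, hno, heq⟩
    · rw [heq]
      exact ⟨h1, t₀, by omega, fun h => absurd c0 h, h4, h5⟩
    · rw [heq]
      have h3' := h3 c0
      refine ⟨by simp only; omega, t₀, by simp only; omega, fun _ => by simp only; omega, h4,
        fun j hj => ?_⟩
      simp only at hj ⊢
      rcases lt_or_ge j (k - (perceptronRun r k S t).2) with hj' | hj'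
      · exact h5 j hj'
      · rw [show t₀ + j = t by omega]
        exact hok
    · exact ⟨by rw [heq], t + 1, by rw [heq]; simp, fun _ => by rw [heq]; simp, rfl,
        by rw [heq]; simp⟩

/-- Every example processed while the learner is active either belongs to the current run of correct
answers or to one of the runs, of length at most `k`, that ended with a mistake. -/
theorem perceptronRun_time (t : ℕ) (h : (perceptronRun r k S t).2 ≠ 0) :
    t + (perceptronRun r k S t).2 ≤ ((perceptronRun r k S t).1.length + 1) * k := by
  induction t with
  | zero => simp [perceptronRun]
  | succ t ih =>
    rcases perceptronRun_succ_eq (r := r) (k := k) (S := S) t with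
      ⟨c0, heq⟩ | ⟨c0, hok, heq⟩ | ⟨c0, hno, heq⟩
    · rw [heq] at h
      exact absurd c0 h
    · have := ih c0
      rw [heq]
      simp only
      omega
    · have := ih c0
      rw [heq]
      simp only [List.length_append, List.length_singleton]
      rw [Nat.add_mul _ 1 k, one_mul]
      omega

theorem perceptronRun_inv {w : (Fin r → Option (Fin d)) → ℝ}
    (hS : ∀ i, 1 / 2 ≤ (exampleSign (S i) : ℝ) * ∑ α, w α * (S i).1.monomial α) (t : ℕ) :
    PerceptronInv r w (perceptronRun r k S t).1 := by
  induction t with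
  | zero => exact PerceptronInv.nil w
  | succ t ih =>
    rcases perceptronRun_succ_eq (r := r) (k := k) (S := S) t with
      ⟨c0, heq⟩ | ⟨c0, hok, heq⟩ | ⟨c0, hno, heq⟩
    · rwa [heq]
    · rwa [heq]
    · rw [heq]
      exact ih.append hno (hS t)

/-- If the examples are separated with a margin, the learner has found, after sufficiently many
examples, a classifier that was correct on `k` examples in a row. -/
theorem exists_perceptronRun_survivor {w : (Fin r → Option (Fin d)) → ℝ} {B : ℝ} {Y : ℕ}
    (hS : ∀ i, 1 / 2 ≤ (exampleSign (S i) : ℝ) * ∑ α, w α * (S i).1.monomial α)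
    (hw : ∑ α, |w α| ≤ B) (hY : 4 * B ^ 2 * ((d : ℝ) + 1) ^ r < Y) :
    ∃ t₀, t₀ + k ≤ k * Y ∧
      (perceptronRun r k S t₀).1 = (perceptronRun r k S (k * Y)).1 ∧
      ∀ j < k, ¬ Errs r (perceptronRun r k S t₀).1 (S (t₀ + j)) := by
  have hlen : (perceptronRun r k S (k * Y)).1.length < Y := by
    have := ((perceptronRun_inv (k := k) hS (k * Y)).length_le hw).trans_lt hY
    exact_mod_cast this
  have hc : (perceptronRun r k S (k * Y)).2 = 0 := by
    by_contra h
    have h1 := perceptronRun_time _ h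
    have h2 : ((perceptronRun r k S (k * Y)).1.length + 1) * k ≤ Y * k :=
      Nat.mul_le_mul_right _ hlen
    rw [Nat.mul_comm Y k] at h2
    omega
  obtain ⟨-, t₀, h1, h2, h3⟩ := perceptronRun_survivor (r := r) (k := k) (S := S) (k * Y)
  rw [hc, Nat.sub_zero] at h1 h3
  exact ⟨t₀, h1, h2, fun j hj => by rw [h2]; exact h3 j hj⟩

end

/-! ### Generalization -/

/-- If the random set `E` is determined by the points with index below `t`, it is unlikely that it
is large and avoids the next `k` points. -/
theorem measureReal_large_and_avoids_le {α : Type*} [Finite α] [MeasurableSpace α]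
    [MeasurableSingletonClass α] (D : Measure α) [IsProbabilityMeasure D] {E : (ℕ → α) → Set α}
    (t k : ℕ) (hE : ∀ ω ω', (∀ i < t, ω i = ω' i) → E ω = E ω') {ε : ℝ} (hε : ε ≤ 1) :
    (Measure.infinitePi fun _ : ℕ => D).real {ω | ε < D.real (E ω) ∧ ∀ j < k, ω (t + j) ∉ E ω}
      ≤ (1 - ε) ^ k := by
  classical
  have := Fintype.ofFinite α
  set μ := Measure.infinitePi fun _ : ℕ => D with hμ
  set C : Set α → Set (ℕ → α) := fun A => {ω | ∀ j < k, ω (t + j) ∉ A} with hC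
  have hindep := (ProbabilityTheory.iIndepFun_infinitePi (P := fun _ : ℕ => D)
    (X := fun _ x => x) fun _ => measurable_id).indepFun_finset (Finset.range t)
      (Finset.Ico t (t + k)) (by
        rw [Finset.disjoint_left]
        intro i hi hi'
        rw [Finset.mem_range] at hi
        rw [Finset.mem_Ico] at hi'
        omega) fun i => measurable_pi_apply i
  -- both events as preimages under restrictions to disjoint sets of indices
  have hpreE : ∀ A, E ⁻¹' {A} = (fun (ω : ℕ → α) (i : Finset.range t) => ω i) ⁻¹'
      {u | ∃ ω, (fun i : Finset.range t => ω i) = u ∧ E ω = A} := fun A => by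
    ext ω
    constructor
    · exact fun h => ⟨ω, rfl, h⟩
    · rintro ⟨ω', h1, h2⟩
      exact (hE ω ω' fun i hi => (congrFun h1 ⟨i, Finset.mem_range.mpr hi⟩).symm).trans h2
  have hpreC : ∀ A, C A = (fun (ω : ℕ → α) (i : Finset.Ico t (t + k)) => ω i) ⁻¹'
      {u | ∀ i, u i ∉ A} := fun A => by
    ext ω
    simp only [hC, Set.mem_ofPred_eq, Set.mem_preimage, Subtype.forall, Finset.mem_Ico]
    constructor
    · rintro h i ⟨hi1, hi2⟩
      have := h (i - t) (by omega)
      rwa [Nat.add_sub_cancel' hi1] at this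
    · exact fun h j hj => h (t + j) ⟨by omega, by omega⟩
  have hmeasE : ∀ A, MeasurableSet (E ⁻¹' {A}) := fun A => by
    rw [hpreE]
    exact (measurable_pi_lambda _ fun i => measurable_pi_apply _) (Set.toFinite _).measurableSet
  have hprod : ∀ A, μ.real (E ⁻¹' {A} ∩ C A) = μ.real (E ⁻¹' {A}) * μ.real (C A) := fun A => by
    rw [measureReal_def, hpreE, hpreC, hindep.measure_inter_preimage_eq_mul _ _
      (Set.toFinite _).measurableSet (Set.toFinite _).measurableSet, ENNReal.toReal_mul]
    rfl
  have hCA : ∀ A, μ.real (C A) = (1 - D.real A) ^ k := fun A => by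
    have : C A = (↑(Finset.Ico t (t + k)) : Set ℕ).pi fun _ => Aᶜ := by
      ext ω
      simp only [hC, Set.mem_ofPred_eq, Set.mem_pi, Finset.coe_Ico, Set.mem_Ico, Set.mem_compl_iff]
      constructor
      · rintro h i ⟨hi1, hi2⟩
        have := h (i - t) (by omega)
        rwa [Nat.add_sub_cancel' hi1] at this
      · exact fun h j hj => h (t + j) ⟨by omega, by omega⟩
    rw [this, measureReal_def, Measure.infinitePi_pi _ fun _ _ => (Set.toFinite _).measurableSet,
      Finset.prod_const, ENNReal.toReal_pow, Nat.card_Ico, Nat.add_sub_cancel_left,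
      ← measureReal_def, probReal_compl_eq_one_sub (Set.toFinite _).measurableSet]
  set F : Finset (Set α) := Finset.univ.filter fun A => ε < D.real A with hF
  have hsub : {ω | ε < D.real (E ω) ∧ ∀ j < k, ω (t + j) ∉ E ω}
      ⊆ ⋃ A ∈ F, E ⁻¹' {A} ∩ C A := fun ω hω => by
    simp only [Set.mem_iUnion]
    exact ⟨E ω, by simpa [hF] using hω.1, rfl, hω.2⟩
  calc μ.real {ω | ε < D.real (E ω) ∧ ∀ j < k, ω (t + j) ∉ E ω}
      ≤ μ.real (⋃ A ∈ F, E ⁻¹' {A} ∩ C A) := measureReal_mono hsub (measure_ne_top _ _)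
    _ ≤ ∑ A ∈ F, μ.real (E ⁻¹' {A} ∩ C A) := measureReal_biUnion_finset_le _ _
    _ ≤ ∑ A ∈ F, μ.real (E ⁻¹' {A}) * (1 - ε) ^ k := by
        refine Finset.sum_le_sum fun A hA => ?_
        rw [hprod, hCA]
        have h1 : ε < D.real A := (Finset.mem_filter.mp hA).2
        have h2 : D.real A ≤ 1 := measureReal_le_one
        gcongr
    _ = μ.real (E ⁻¹' ↑F) * (1 - ε) ^ k := by
        rw [← Finset.sum_mul, sum_measureReal_preimage_singleton F fun A _ => hmeasE A]
    _ ≤ 1 * (1 - ε) ^ k := by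
        have : 0 ≤ 1 - ε := by linarith
        gcongr
        exact measureReal_le_one
    _ = (1 - ε) ^ k := one_mul _

/-- The union bound over all starting points of a block of `k` examples costs a factor `k * Y`; the
factor `⌈1/ε⌉²` in `k` compensates for it through `exp (-u) ≤ 2 / u ^ 2` at `u = ε k`. -/
theorem patience_mul_pow_le {D a Y : ℕ} {ε δ : ℝ} (hε : 0 < ε) (hε1 : ε < 1) (hδ : 0 < δ)
    (ha : 1 / ε ≤ a) (hD : 1 / δ ≤ D) (hY : 0 < Y) :
    ((patience D a Y * Y : ℕ) : ℝ) * (1 - ε) ^ patience D a Y ≤ δ := by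
  set k := patience D a Y with hk
  have ha' : 1 ≤ ε * a := by rwa [div_le_iff₀' hε] at ha
  have hD' : 1 ≤ δ * D := by rwa [div_le_iff₀' hδ] at hD
  have hY' : (0 : ℝ) < Y := by exact_mod_cast hY
  have hkval : (k : ℝ) = Y * a * a * (2 * D) := by rw [hk, patience]; push_cast; ring
  have hkey : 2 * Y ≤ δ * ε ^ 2 * k := by
    have : δ * ε ^ 2 * k = 2 * Y * ((ε * a) * (ε * a) * (δ * D)) := by rw [hkval]; ring
    rw [this]
    have h1 : 1 ≤ (ε * a) * (ε * a) := one_le_mul_of_one_le_of_one_le ha' ha'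
    exact le_mul_of_one_le_right (by positivity) (one_le_mul_of_one_le_of_one_le h1 hD')
  have hk0 : (0 : ℝ) < k := by
    by_contra h
    have h' : (k : ℝ) = 0 := le_antisymm (not_lt.mp h) (Nat.cast_nonneg _)
    rw [h'] at hkey
    linarith
  have hpow : (1 - ε) ^ k ≤ Real.exp (-(ε * k)) := by
    calc (1 - ε) ^ k ≤ Real.exp (-ε) ^ k := by
          have := Real.add_one_le_exp (-ε)
          have h2 : 0 ≤ 1 - ε := by linarith
          gcongr
          linarith
      _ = Real.exp (-(ε * k)) := by rw [← Real.exp_nat_mul]; congr 1; ring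
  have hx : 0 < ε * k := by positivity
  have hexp : (ε * k) ^ 2 / 2 ≤ Real.exp (ε * k) := by
    have := Real.quadratic_le_exp_of_nonneg hx.le
    linarith
  push_cast
  calc (k : ℝ) * Y * (1 - ε) ^ k ≤ k * Y * Real.exp (-(ε * k)) := by gcongr
    _ ≤ k * Y * ((ε * k) ^ 2 / 2)⁻¹ := by
        rw [Real.exp_neg]
        gcongr
    _ = 2 * Y / (ε ^ 2 * k) := by field_simp
    _ ≤ δ := by
        rw [div_le_iff₀ (by positivity)]
        linarith

/-- With probability at least `1 - δ`, the final classifier of the learner has error at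
most `ε`. -/
theorem one_sub_le_measureReal_perceptronRun {d r Y a C : ℕ} (D : Measure (Cube d))
    [IsProbabilityMeasure D] (y : Cube d → SignType) {w : (Fin r → Option (Fin d)) → ℝ} {B : ℝ}
    (hmargin : ∀ᵐ x ∂D, 1 / 2 ≤ (exampleSign (x, y x) : ℝ) * ∑ α, w α * x.monomial α)
    (hw : ∑ α, |w α| ≤ B) (hY : 4 * B ^ 2 * ((d : ℝ) + 1) ^ r < Y) {ε δ : ℝ} (hε : 0 < ε)
    (hε1 : ε < 1) (hδ : 0 < δ) (ha : 1 / ε ≤ a) (hC : 1 / δ ≤ C) :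
    1 - δ ≤ (Measure.infinitePi fun _ : ℕ => D).real {ω | D.real {x |
      Errs r (perceptronRun r (patience C a Y) (fun i => (ω i, y (ω i))) (patience C a Y * Y)).1
        (x, y x)} ≤ ε} := by
  have hY0 : 0 < Y := by
    have : (0 : ℝ) < Y := lt_of_le_of_lt (by positivity) hY
    exact_mod_cast this
  have htail := patience_mul_pow_le hε hε1 hδ ha hC hY0
  set k := patience C a Y with hk
  have hk0 : 0 < k := by
    have h1 : (0 : ℝ) < a := lt_of_lt_of_le (by positivity) ha
    have h2 : (0 : ℝ) < C := lt_of_lt_of_le (by positivity) hC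
    have h3 : 0 < a := by exact_mod_cast h1
    have h4 : 0 < C := by exact_mod_cast h2
    rw [hk, patience]
    positivity
  set μ := Measure.infinitePi fun _ : ℕ => D with hμ
  set E : ℕ → (ℕ → Cube d) → Set (Cube d) := fun t ω =>
    {x | Errs r (perceptronRun r k (fun i => (ω i, y (ω i))) t).1 (x, y x)} with hEdef
  change 1 - δ ≤ μ.real {ω | D.real (E (k * Y) ω) ≤ ε}
  set G := {ω | D.real (E (k * Y) ω) ≤ ε} with hG
  set Bad : ℕ → Set (ℕ → Cube d) := fun t =>
    {ω | ε < D.real (E t ω) ∧ ∀ j < k, ω (t + j) ∉ E t ω} with hBad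
  have hBadle : ∀ t, μ.real (Bad t) ≤ (1 - ε) ^ k := fun t =>
    measureReal_large_and_avoids_le D t k (fun ω ω' h => by
      simp only [hEdef]
      rw [perceptronRun_congr fun i hi => by rw [h i hi]]) hε1.le
  set N := {ω : ℕ → Cube d | ¬ ∀ i, 1 / 2 ≤ (exampleSign (ω i, y (ω i)) : ℝ) *
    ∑ α, w α * (ω i).monomial α} with hN
  have hN0 : μ.real N = 0 := by
    have : ∀ᵐ ω ∂μ, ∀ i, 1 / 2 ≤ (exampleSign (ω i, y (ω i)) : ℝ) *
        ∑ α, w α * (ω i).monomial α := by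
      rw [ae_all_iff]
      exact fun i => (measurePreserving_eval_infinitePi (fun _ : ℕ => D) i).quasiMeasurePreserving.ae
        hmargin
    rw [measureReal_def, ae_iff.mp this, ENNReal.toReal_zero]
  have hcover : (Set.univ : Set (ℕ → Cube d)) ⊆ G ∪ (N ∪ ⋃ t ∈ Finset.range (k * Y), Bad t) := by
    intro ω _
    by_cases hωN : ω ∈ N
    · exact Or.inr (Or.inl hωN)
    by_cases hωG : ω ∈ G
    · exact Or.inl hωG
    refine Or.inr (Or.inr ?_)
    have hωN' := not_not.mp hωN
    obtain ⟨t₀, h1, h2, h3⟩ := exists_perceptronRun_survivor (k := k)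
      (S := fun i => (ω i, y (ω i))) hωN' hw hY
    simp only [Set.mem_iUnion]
    refine ⟨t₀, Finset.mem_range.mpr (by omega), ?_, fun j hj => h3 j hj⟩
    simp only [hEdef, h2]
    exact not_le.mp hωG
  have h1 : 1 ≤ μ.real G + (μ.real N + ∑ t ∈ Finset.range (k * Y), μ.real (Bad t)) := by
    calc 1 = μ.real Set.univ := by simp
      _ ≤ μ.real (G ∪ (N ∪ ⋃ t ∈ Finset.range (k * Y), Bad t)) := measureReal_mono hcover
      _ ≤ _ := by
          refine (measureReal_union_le _ _).trans ?_
          gcongr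
          refine (measureReal_union_le _ _).trans ?_
          gcongr
          exact measureReal_biUnion_finset_le _ _
  have h2 : ∑ t ∈ Finset.range (k * Y), μ.real (Bad t) ≤ ((k * Y : ℕ) : ℝ) * (1 - ε) ^ k := by
    calc ∑ t ∈ Finset.range (k * Y), μ.real (Bad t)
        ≤ ∑ t ∈ Finset.range (k * Y), (1 - ε) ^ k := Finset.sum_le_sum fun t _ => hBadle t
      _ = _ := by rw [Finset.sum_const, Finset.card_range, nsmul_eq_mul]
  linarith

/-! ### Running time and choice of the parameters -/

/-- The running times of the learner and of the evaluation, in terms of the mistake bound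
`(d + 1) ^ q`. -/
theorem cost_le {D d r q a : ℕ} (hd : 1 ≤ d) (hD : 1 ≤ D) (ha : 1 ≤ a) (hq : 1 ≤ q) (hr : r ≤ q) :
    learnCost D d r q a ≤ 448 * D ^ 2 * a ^ 4 * ((d + 1) ^ q) ^ 6 ∧
      (patience D a ((d + 1) ^ q) * (d + 1) ^ q) * rowCost d r + 6
        ≤ 448 * D ^ 2 * a ^ 4 * ((d + 1) ^ q) ^ 6 := by
  set Y := (d + 1) ^ q with hYdef
  set T := patience D a Y * Y with hT
  have hTval : T = 2 * D * a ^ 2 * Y ^ 2 := by rw [hT, patience]; ring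
  have hdY : d + 1 ≤ Y := Nat.le_self_pow (by omega) _
  have hqY : q + 1 ≤ Y := Nat.lt_pow_self (by omega)
  have hY1 : 1 ≤ Y := by omega
  have hYY : Y ≤ Y ^ 2 := Nat.le_self_pow (by norm_num) _
  have hqd : q * d ≤ Y ^ 2 := by
    rw [pow_two]
    exact Nat.mul_le_mul (by omega) (by omega)
  have hrd : r * d ≤ Y ^ 2 := (Nat.mul_le_mul_right _ hr).trans hqd
  -- every parameter is bounded by the number `T` of examples
  have haT : 2 * a ≤ T := by
    rw [hTval]
    calc 2 * a ≤ 2 * a ^ 2 * (D * Y ^ 2) :=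
          (Nat.mul_le_mul_left 2 (Nat.le_self_pow (by norm_num) a)).trans
            (Nat.le_mul_of_pos_right _ (by positivity))
      _ = _ := by ring
  have hDT : 2 * D ≤ T := by
    rw [hTval, mul_assoc (2 * D)]
    exact Nat.le_mul_of_pos_right _ (by positivity)
  have hYT : 2 * Y ^ 2 ≤ T := by
    rw [hTval]
    calc 2 * Y ^ 2 ≤ 2 * Y ^ 2 * (D * a ^ 2) := Nat.le_mul_of_pos_right _ (by positivity)
      _ = _ := by ring
  have hrow : rowCost d r ≤ 39 * Y ^ 2 := by
    rw [rowCost, mul_add, mul_left_comm]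
    omega
  have hTY : T ≤ T * Y ^ 2 := Nat.le_mul_of_pos_right _ (by positivity)
  have hTrow : T * rowCost d r ≤ 39 * (T * Y ^ 2) := by
    calc T * rowCost d r ≤ T * (39 * Y ^ 2) := Nat.mul_le_mul_left _ hrow
      _ = _ := by ring
  have hTT : T * Y ^ 2 ≤ T * (T * Y ^ 2) := Nat.le_mul_of_pos_left _ (by omega)
  have hbound : 448 * D ^ 2 * a ^ 4 * Y ^ 6 = 112 * (T * (T * Y ^ 2)) := by rw [hTval]; ring
  rw [hbound]
  constructor
  · have hex : T * exampleCost d r T ≤ T * (64 * (T * Y ^ 2)) := by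
      refine Nat.mul_le_mul_left _ ?_
      rw [exampleCost]
      omega
    have hqd' : q * (3 * d + 10) ≤ 13 * Y ^ 2 := by
      rw [mul_add, mul_left_comm]
      omega
    rw [mul_left_comm T 64] at hex
    rw [learnCost, ← hYdef, ← hT]
    omega
  · omega

/-- The exponent `24` and the constant `K = 7168 ⌈1/δ⌉² 128 ^ 6` suffice for the running time if the
mistake bound `Y` is at most `128` or at most `P ^ 4`. The first case is dimension one, where
`Y = 2 ^ 7`. -/
theorem time_le {D a Y : ℕ} {ε P : ℝ} (hD : 1 ≤ D) (hε : 0 < ε) (hε1 : ε < 1)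
    (ha : (a : ℝ) ≤ 2 / ε) (hP : 1 ≤ P) (hY : (Y : ℝ) ^ 6 ≤ 128 ^ 6 * P ^ 24) :
    ((448 * D ^ 2 * a ^ 4 * Y ^ 6 : ℕ) : ℝ)
      ≤ ((1 / ε) * ((7168 * D ^ 2 * 128 ^ 6 : ℕ) * P)) ^ 24 := by
  have hε' : 1 ≤ 1 / ε := by rw [le_div_iff₀ hε]; linarith
  have hK : (1 : ℝ) ≤ (7168 * D ^ 2 * 128 ^ 6 : ℕ) := by
    exact_mod_cast Nat.succ_le_of_lt (by positivity)
  have h4 : (a : ℝ) ^ 4 ≤ 16 * (1 / ε) ^ 24 := by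
    calc (a : ℝ) ^ 4 ≤ (2 / ε) ^ 4 := by gcongr
      _ = 16 * (1 / ε) ^ 4 := by ring
      _ ≤ 16 * (1 / ε) ^ 24 := by gcongr; norm_num
  have hK' : ((7168 * D ^ 2 * 128 ^ 6 : ℕ) : ℝ) ≤ (7168 * D ^ 2 * 128 ^ 6 : ℕ) ^ 24 :=
    le_self_pow₀ hK (by norm_num)
  calc ((448 * D ^ 2 * a ^ 4 * Y ^ 6 : ℕ) : ℝ) = 448 * D ^ 2 * (a : ℝ) ^ 4 * (Y : ℝ) ^ 6 := by
        push_cast; ring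
    _ ≤ 448 * D ^ 2 * (16 * (1 / ε) ^ 24) * (128 ^ 6 * P ^ 24) := by gcongr
    _ = (1 / ε) ^ 24 * (((7168 * D ^ 2 * 128 ^ 6 : ℕ) : ℝ) * P ^ 24) := by push_cast; ring
    _ ≤ (1 / ε) ^ 24 * (((7168 * D ^ 2 * 128 ^ 6 : ℕ) : ℝ) ^ 24 * P ^ 24) := by gcongr
    _ = _ := by rw [mul_pow, mul_pow]

/-- The learner succeeds if the sign of the target is, with a margin, that of a polynomial of
degree `r` with coefficients of `ℓ₁`-norm at most `B`. -/
theorem learnsWithin_of_polyRep {r₁ q₁ r₂ q₂ C d r q : ℕ} {ε δ t B : ℝ}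
    (hparam : (d = 1 ∧ r = r₁ ∧ q = q₁) ∨ (2 ≤ d ∧ r = r₂ ∧ q = q₂))
    (hε : 0 < ε) (hε1 : ε < 1) (hδ : 0 < δ) (hC : 1 / δ ≤ C)
    {f : (Fin d → ℝ) → ℝ} (D : Measure (Cube d)) [IsProbabilityMeasure D]
    (hf : ∀ᵐ x ∂D, 1 ≤ |f x.toReal|) {g : Cube d → ℝ} (hg : PolyRep r g B)
    (hfg : ∀ x : Cube d, 1 ≤ |f x.toReal| →
      1 / 2 ≤ (exampleSign (x, SignType.sign (f x.toReal)) : ℝ) * g x)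
    (hB : 4 * B ^ 2 * ((d : ℝ) + 1) ^ r < ((d + 1) ^ q : ℕ))
    (ht : (learnCost C d r q ⌈1 / ε⌉₊ : ℝ) ≤ t)
    (ht' : (((patience C ⌈1 / ε⌉₊ ((d + 1) ^ q) * (d + 1) ^ q) * rowCost d r + 6 : ℕ) : ℝ) ≤ t) :
    LearnsWithin (learnProg r₁ q₁ r₂ q₂ C) queryProg ε δ t f D := by
  obtain ⟨w, hw, hgw⟩ := hg
  set a := ⌈1 / ε⌉₊ with ha
  set Y := (d + 1) ^ q with hY
  refine ⟨fun ω x => if 0 < kernelSum r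
    (perceptronRun r (patience C a Y) (labelled f ω) (patience C a Y * Y)).1 x then 1 else -1,
    fun ω => ?_, ?_⟩
  · obtain ⟨τ, s, hexec, hτ, hrep⟩ := wp_learnProg (S := labelled f ω) r₁ q₁ r₂ q₂ C a r q hparam
      (s := learnerStart d ε) rfl (by
        simp only [learnerStart, one_ne_zero, if_false, if_true]
        exact (Int.natCast_ceil_eq_ceil (by positivity)).symm) (fun i hi => by
        simp [learnerStart, show i ≠ 0 by omega, show i ≠ 1 by omega]) rfl
    refine ⟨τ, s, hexec, le_trans (by exact_mod_cast hτ) ht, fun x => ?_⟩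
    obtain ⟨τ', s', hexec', hτ', hout⟩ := wp_queryProg hrep x
    refine ⟨τ', s', hexec', le_trans ?_ ht', ?_⟩
    · have hlen := length_perceptronRun_le (S := labelled f ω) r (patience C a Y)
        (patience C a Y * Y)
      exact_mod_cast hτ'.trans (by gcongr)
    · simp only [MState.output, hout]
      rfl
  · have h := one_sub_le_measureReal_perceptronRun (r := r) (Y := Y) (a := a) (C := C) D
      (fun x => SignType.sign (f x.toReal)) (w := w) (B := B)
      (hf.mono fun x hx => by rw [← hgw]; exact hfg x hx) hw hB hε hε1 hδ (Nat.le_ceil _) hC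
    refine h.trans (measureReal_mono fun ω hω => ?_)
    rw [Set.mem_ofPred_eq] at hω ⊢
    refine le_trans ?_ hω
    -- outside of the null set where the margin assumption fails the label is not `0`
    refine ENNReal.toReal_mono (measure_ne_top _ _) (measure_mono_ae ?_)
    filter_upwards [hf] with x hx hne
    intro hiff
    apply hne
    have hiff' : (0 < kernelSum r (perceptronRun r (patience C a Y) (labelled f ω)
      (patience C a Y * Y)).1 x ↔ 0 < SignType.sign (f x.toReal)) := hiff
    have hf0 : f x.toReal ≠ 0 := fun h0 => by rw [h0] at hx; norm_num at hx
    rcases lt_or_gt_of_ne hf0 with hneg | hpos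
    · have : SignType.sign (f x.toReal) = -1 := sign_neg hneg
      rw [this] at hiff' ⊢
      exact if_neg fun h => absurd (hiff'.mp h) (by decide)
    · have : SignType.sign (f x.toReal) = 1 := sign_pos hpos
      rw [this] at hiff' ⊢
      exact if_pos (hiff'.mpr (by decide))

theorem exampleSign_eq_of_pos {d : ℕ} (x : Cube d) {u : ℝ} (hu : 0 < u) :
    exampleSign (x, SignType.sign u) = 1 := by
  simp [exampleSign, sign_pos hu]

theorem exampleSign_eq_of_neg {d : ℕ} (x : Cube d) {u : ℝ} (hu : u < 0) :
    exampleSign (x, SignType.sign u) = -1 := by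
  simp [exampleSign, sign_neg hu]

theorem half_le_exampleSign_mul {d : ℕ} (x : Cube d) {u v : ℝ} (hu : 1 ≤ |u|)
    (huv : |v - u| ≤ 1 / 2) : 1 / 2 ≤ (exampleSign (x, SignType.sign u) : ℝ) * v := by
  have := abs_le.mp huv
  rcases le_abs.mp hu with h | h
  · rw [exampleSign_eq_of_pos x (by linarith)]
    push_cast
    linarith
  · rw [exampleSign_eq_of_neg x (by linarith)]
    push_cast
    linarith

/-- The degree of the polynomials used in dimension at least two. -/
noncomputable def kernelDegree (L : ℝ) : ℕ := ⌈L * Real.log (11 * L ^ 2 + 1)⌉₊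

/-- The exponent of the mistake bound in dimension at least two. -/
noncomputable def mistakeExponent (L : ℝ) : ℕ := 3 * kernelDegree L + 2 * ⌈L⌉₊ + 3

theorem kernelDegree_spec {L : ℝ} (hL : 1 ≤ L) :
    4 * L * Real.exp (-(kernelDegree L / L)) ≤ 1 / (2 * L) := by
  have hL0 : 0 < L := by linarith
  have h1 : Real.log (11 * L ^ 2 + 1) ≤ kernelDegree L / L := by
    rw [le_div_iff₀ hL0, mul_comm]
    exact Nat.le_ceil _
  have h2 : 11 * L ^ 2 + 1 ≤ Real.exp (kernelDegree L / L) := by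
    rw [← Real.log_le_iff_le_exp (by positivity)]
    exact h1
  rw [Real.exp_neg, ← div_eq_mul_inv, div_le_div_iff₀ (Real.exp_pos _) (by positivity)]
  nlinarith

theorem mistakeExponent_spec {L : ℝ} (hL : 1 ≤ L) {d : ℕ} (hd : 2 ≤ d) :
    4 * (2 * L * 3 ^ kernelDegree L) ^ 2 * ((d : ℝ) + 1) ^ kernelDegree L
      < ((d + 1) ^ mistakeExponent L : ℕ) := by
  set r := kernelDegree L with hr
  have hd' : (3 : ℝ) ≤ (d : ℝ) + 1 := by
    have : (2 : ℝ) ≤ d := by exact_mod_cast hd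
    linarith
  have hLc : L ≤ ((d : ℝ) + 1) ^ ⌈L⌉₊ := by
    calc L ≤ (⌈L⌉₊ : ℝ) := Nat.le_ceil _
      _ ≤ (3 : ℝ) ^ ⌈L⌉₊ := by exact_mod_cast (Nat.lt_pow_self (by norm_num)).le
      _ ≤ _ := by gcongr
  push_cast
  calc 4 * (2 * L * 3 ^ r) ^ 2 * ((d : ℝ) + 1) ^ r
      < 27 * (L * 3 ^ r) ^ 2 * ((d : ℝ) + 1) ^ r := by
        have : 0 < (L * 3 ^ r) ^ 2 * ((d : ℝ) + 1) ^ r := by positivity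
        nlinarith
    _ ≤ ((d : ℝ) + 1) ^ 3 * (((d : ℝ) + 1) ^ ⌈L⌉₊ * ((d : ℝ) + 1) ^ r) ^ 2 * ((d : ℝ) + 1) ^ r := by
        gcongr
        calc (27 : ℝ) = 3 ^ 3 := by norm_num
          _ ≤ _ := by gcongr
    _ = ((d : ℝ) + 1) ^ mistakeExponent L := by
        rw [mistakeExponent, ← hr]
        ring

/-- The mistake bound is polynomial in `d ^ (4 L ln (11 L² + 1))`, uniformly in `L`. -/
theorem mistakeBound_le {L : ℝ} (hL : 1 ≤ L) {d : ℕ} (hd : 2 ≤ d) :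
    (((d + 1) ^ mistakeExponent L : ℕ) : ℝ)
      ≤ ((d : ℝ) ^ (4 * L * Real.log (11 * L ^ 2 + 1))) ^ 4 := by
  have hL0 : 0 < L := by linarith
  have hd2 : (2 : ℝ) ≤ d := by exact_mod_cast hd
  have hd0 : (0 : ℝ) < d := by linarith
  have hlog : 2 ≤ Real.log (11 * L ^ 2 + 1) := by
    rw [Real.le_log_iff_exp_le (by positivity)]
    have h1 := Real.exp_one_lt_d9
    have h2 : Real.exp 2 = Real.exp 1 * Real.exp 1 := by rw [← Real.exp_add]; norm_num
    have h3 := Real.exp_pos 1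
    rw [h2]
    nlinarith
  set E := 4 * L * Real.log (11 * L ^ 2 + 1) with hE
  have hE8 : 8 * L ≤ E := by rw [hE]; nlinarith
  have hr : (kernelDegree L : ℝ) ≤ E / 4 + 1 := by
    have := (Nat.ceil_lt_add_one (a := L * Real.log (11 * L ^ 2 + 1)) (by positivity)).le
    rw [kernelDegree, hE]
    linarith
  have hc : (⌈L⌉₊ : ℝ) ≤ L + 1 := (Nat.ceil_lt_add_one hL0.le).le
  have hq : (2 * mistakeExponent L : ℕ) ≤ E * (4 : ℕ) := by
    rw [mistakeExponent]
    push_cast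
    linarith
  rw [← Real.rpow_mul_natCast hd0.le]
  calc (((d + 1) ^ mistakeExponent L : ℕ) : ℝ) ≤ ((d : ℝ) ^ 2) ^ mistakeExponent L := by
        push_cast
        gcongr
        nlinarith
    _ = (d : ℝ) ^ ((2 * mistakeExponent L : ℕ) : ℝ) := by rw [← pow_mul, Real.rpow_natCast]
    _ ≤ _ := Real.rpow_le_rpow_of_exponent_le (by linarith) hq

theorem mainTheorem2 :
    ∃ c : ℕ, ∀ δ : ℝ, 0 < δ → δ < 1 → ∃ K : ℝ, 0 < K ∧
      ∀ L : ℝ, 0 < L → ∃ A Q : Cmd,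
        ∀ (d : ℕ), 1 ≤ d → ∀ ε : ℝ, 0 < ε → ε < 1 →
        ∀ (n : ℕ), ∀ f ∈ NetClass d 2 n Real.sigmoid L,
        ∀ (D : Measure (Cube d)) [IsProbabilityMeasure D],
          (∀ᵐ x ∂D, 1 ≤ |f x.toReal|) →
          LearnsWithin A Q ε δ
            (((1 / ε) * (K * (d : ℝ) ^ (4 * L * Real.log (11 * L ^ 2 + 1)))) ^ c) f D := by
  refine ⟨24, fun δ hδ _ => ?_⟩
  set C := ⌈1 / δ⌉₊ with hC
  have hC1 : 1 ≤ C := Nat.one_le_ceil_iff.mpr (by positivity)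
  refine ⟨(7168 * C ^ 2 * 128 ^ 6 : ℕ), by exact_mod_cast by positivity, fun L hL0 =>
    ⟨learnProg 1 7 (kernelDegree L) (mistakeExponent L) C, queryProg, ?_⟩⟩
  intro d hd ε hε hε1 n f hf D _ hmargin
  -- the margin assumption can be satisfied only if the weight bound is at least `1`
  have hL : 1 ≤ L := by
    obtain ⟨x, hx⟩ := hmargin.exists
    exact hx.trans (abs_le_of_mem_netClass hf _)
  have hε' : 1 < 1 / ε := by rw [lt_div_iff₀ hε]; linarith
  have ha1 : 1 ≤ ⌈1 / ε⌉₊ := Nat.one_le_ceil_iff.mpr (by positivity)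
  have ha2 : (⌈1 / ε⌉₊ : ℝ) ≤ 2 / ε := by
    have := (Nat.ceil_lt_add_one (a := 1 / ε) (by positivity)).le
    calc (⌈1 / ε⌉₊ : ℝ) ≤ 1 / ε + 1 := this
      _ ≤ 1 / ε + 1 / ε := by linarith
      _ = 2 / ε := by ring
  have hd1 : (1 : ℝ) ≤ d := by exact_mod_cast hd
  have hP : 1 ≤ (d : ℝ) ^ (4 * L * Real.log (11 * L ^ 2 + 1)) :=
    Real.one_le_rpow hd1 (mul_nonneg (by linarith) (Real.log_nonneg (by nlinarith)))
  rcases Nat.eq_or_lt_of_le hd with rfl | hd2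
  · -- in dimension one the labels themselves are a linear polynomial, whatever `L` is
    have hcost := cost_le (D := C) (d := 1) (r := 1) (q := 7) le_rfl hC1 ha1 (by norm_num)
      (by norm_num)
    have htime := time_le (Y := (1 + 1) ^ 7) hC1 hε hε1 ha2 hP (by
      norm_num)
    refine learnsWithin_of_polyRep (Or.inl ⟨rfl, rfl, rfl⟩) hε hε1 hδ (Nat.le_ceil _) D hmargin
      (exists_polyRep_one (fun x => ((SignType.sign (f x.toReal) : ℤ) : ℝ)) fun x => ?_)
      (fun x hx => ?_) ?_ (le_trans (by exact_mod_cast hcost.1) htime)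
      (le_trans (by exact_mod_cast hcost.2) htime)
    · cases SignType.sign (f x.toReal) <;> simp
    · rcases le_abs.mp hx with h | h
      · rw [exampleSign_eq_of_pos x (by linarith), sign_pos (by linarith)]
        norm_num
      · rw [exampleSign_eq_of_neg x (by linarith), sign_neg (by linarith)]
        norm_num
    · norm_num
  · have hcost := cost_le (D := C) (d := d) (r := kernelDegree L) (q := mistakeExponent L) hd hC1
      ha1 (by unfold mistakeExponent; omega) (by unfold mistakeExponent; omega)
    have htime := time_le (Y := (d + 1) ^ mistakeExponent L) hC1 hε hε1 ha2 hP (by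
      have := mistakeBound_le hL hd2
      calc (((d + 1) ^ mistakeExponent L : ℕ) : ℝ) ^ 6
          ≤ (((d : ℝ) ^ (4 * L * Real.log (11 * L ^ 2 + 1))) ^ 4) ^ 6 := by gcongr
        _ = 1 * ((d : ℝ) ^ (4 * L * Real.log (11 * L ^ 2 + 1))) ^ 24 := by
          rw [← pow_mul, one_mul]
        _ ≤ _ := by gcongr; norm_num)
    obtain ⟨g, hg, hfg⟩ := exists_polyRep_of_mem_netClass hL (kernelDegree_spec hL) hf
    exact learnsWithin_of_polyRep (Or.inr ⟨hd2, rfl, rfl⟩) hε hε1 hδ (Nat.le_ceil _) D hmargin hg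
      (fun x hx => half_le_exampleSign_mul x hx (hfg x)) (mistakeExponent_spec hL hd2)
      (le_trans (by exact_mod_cast hcost.1) htime) (le_trans (by exact_mod_cast hcost.2) htime)
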